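/- Let $X$ be a set, $(\Omega,\mathcal F,P)$ a probability space, $F(0)\subseteq F(1)\subseteq\dots\subseteq\mathcal F$ a filtration with $F(0)=\{\emptyset,\Omega\}$, and $\xi_1,\xi_2,\dots$ real random fields on $X$ which are centered martingale differences: for all $x\in X$ and $i\ge 1$, $\xi_i(x)$ is integrable, $E[\xi_i(x)\mid F(k)]=0$ a.s. for $0\le k<i$, and $E[\xi_i(x)\mid F(i)]=\xi_i(x)$ a.s. Put $\eta_n(x)=n^{-1/2}\sum_{i=1}^n\xi_i(x)$ for $n\ge1$. Let $q>0$. For a real random variable $\zeta$ put $\|\zeta\|_{(q)}=\sup_{p\ge 2}\,(E|\zeta|^p)^{1/p}/p^{1/q}$ (supremum over real $p$), and define $$\rho_q(x_1,x_2)=\sup_{k\ge1}\|\xi_k(x_1)-\xi_k(x_2)\|_{(q)},\qquad D=\sup_{x_1,x_2\in X}\rho_q(x_1,x_2),$$ $$\sigma^2=\inf_{x\in X}\ \sup_{n\ge1}\ \frac1n\sum_{k=1}^n\operatorname{Var}(\xi_k(x)).$$ Let $H(X,\rho_q,\varepsilon)=\log N(X,\rho_q,\varepsilon)$, where $N(X,\rho_q,\varepsilon)$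 is the least number of closed $\rho_q$-balls of radius $\varepsilon$ with centers in $X$ that cover $X$ ($H=\infty$ if no finite number suffices). Let $C(X,\rho_q)$ be the Banach space of bounded real functions on $X$ that are continuous for the semi-distance $\rho_q$, with the sup norm and its Borel $\sigma$-algebra (all continuous functions, if $(X,\rho_q)$ is compact). **Theorem 2.2.** Suppose that $\rho_q$ is bounded, that $\sigma^2<\infty$ (in particular $X\neq\emptyset$), and that $$\int_0^{D} H(X,\rho_q,\varepsilon)^{(2+q)/(2q)}\,d\varepsilon<\infty .$$ Then every $\xi_i$ has a modification which is a random element of $C(X,\rho_q)$, and the family of distributions of $\eta_n$, $n\ge1$, is weakly compact in $C(X,\rho_q)$ in Prokhorov's sense. That is, for any choice of modifications $\tilde\eta_n$ of $\eta_n$ (i.e. $\tilde\eta_n(x)=\eta_n(x)$ a.s. for each $x\in X$) with all sample paths in $C(X,\rho_q)$, each $\tilde\eta_n$ is a random element of $C(X,\rho_q)$ (measurable up to modification on a null set), and the set of the laws of $\tilde\eta_n$, $n\ge1$, is tight and has compact closure in the topology of weak convergence of probability measures on $C(X,\rho_q)$. -/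

import Mathlib

open MeasureTheory ProbabilityTheory Filter Set
open scoped ENNReal NNReal BoundedContinuousFunction

noncomputable section

universe u v

/-- The norm `‖f‖_(q) = sup_{p ≥ 2} |f|_p / p^{1/q}` (the supremum is over real `p`), with values in
`[0, ∞]`; here `|f|_p = (E |f|^p)^{1/p}`. -/
def qNorm {Ω : Type v} [MeasurableSpace Ω] (P : Measure Ω) (q : ℝ) (f : Ω → ℝ) : ℝ≥0∞ :=
  ⨆ (p : ℝ) (_ : 2 ≤ p), eLpNorm f (ENNReal.ofReal p) P / ENNReal.ofReal (p ^ (1 / q))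

/-- A sequence `ξ 1, ξ 2, …` of real random fields on the set `X` which are centered martingale
differences with respect to a filtration `F 0 ⊆ F 1 ⊆ …` with trivial `F 0`. The value `ξ 0` is
not used. -/
structure MartingaleDifferenceField (X : Type u) {Ω : Type v} [mΩ : MeasurableSpace Ω]
    (P : Measure Ω) where
  /-- the filtration -/
  F : Filtration ℕ mΩ
  F_zero : F 0 = ⊥
  /-- the random fields: `ξ i x ω` -/
  ξ : ℕ → X → Ω → ℝ
  integrable : ∀ i, 1 ≤ i → ∀ x, Integrable (ξ i x) P
  condExp_of_lt : ∀ i k, k < i → ∀ x, P[ξ i x | F k] =ᵐ[P] 0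
  condExp_self : ∀ i, 1 ≤ i → ∀ x, P[ξ i x | F i] =ᵐ[P] ξ i x

/-- The entropy `H(Y, ε) = log N(Y, ε)`, where `N(Y, ε)` is the minimal number of closed
`ε`-balls with centers in `Y` covering `Y`; it is `∞` if there is no finite cover. -/
def entropy (Y : Type u) [PseudoEMetricSpace Y] (ε : ℝ≥0) : ℝ≥0∞ :=
  (ENNReal.log ((Metric.coveringNumber ε (univ : Set Y) : ℕ∞) : ℝ≥0∞)).toENNReal

theorem qNorm_zero {Ω : Type v} [MeasurableSpace Ω] (P : Measure Ω) (q : ℝ) :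
    qNorm P q (0 : Ω → ℝ) = 0 := by
  simp [qNorm]

theorem qNorm_sub_comm {Ω : Type v} [MeasurableSpace Ω] (P : Measure Ω) (q : ℝ) (f g : Ω → ℝ) :
    qNorm P q (f - g) = qNorm P q (g - f) := by
  simp only [qNorm, eLpNorm_sub_comm f g]

theorem qNorm_add_le {Ω : Type v} [MeasurableSpace Ω] (P : Measure Ω) (q : ℝ) {f g : Ω → ℝ}
    (hf : AEStronglyMeasurable f P) (hg : AEStronglyMeasurable g P) :
    qNorm P q (f + g) ≤ qNorm P q f + qNorm P q g := by
  unfold qNorm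
  refine iSup₂_le fun p hp => ?_
  have h1 : (1 : ℝ≥0∞) ≤ ENNReal.ofReal p := by
    rw [← ENNReal.ofReal_one]
    exact ENNReal.ofReal_le_ofReal (by linarith)
  calc eLpNorm (f + g) (ENNReal.ofReal p) P / ENNReal.ofReal (p ^ (1 / q))
      ≤ (eLpNorm f (ENNReal.ofReal p) P + eLpNorm g (ENNReal.ofReal p) P)
          / ENNReal.ofReal (p ^ (1 / q)) :=
        ENNReal.div_le_div_right (eLpNorm_add_le hf hg h1) _
    _ = eLpNorm f (ENNReal.ofReal p) P / ENNReal.ofReal (p ^ (1 / q))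
          + eLpNorm g (ENNReal.ofReal p) P / ENNReal.ofReal (p ^ (1 / q)) := ENNReal.add_div
    _ ≤ _ := add_le_add
        (le_iSup₂ (f := fun (p : ℝ) (_ : 2 ≤ p) =>
          eLpNorm f (ENNReal.ofReal p) P / ENNReal.ofReal (p ^ (1 / q))) p hp)
        (le_iSup₂ (f := fun (p : ℝ) (_ : 2 ≤ p) =>
          eLpNorm g (ENNReal.ofReal p) P / ENNReal.ofReal (p ^ (1 / q))) p hp)

namespace MartingaleDifferenceField

variable {X : Type u} {Ω : Type v} [MeasurableSpace Ω] {P : Measure Ω}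

/-- The normed sums `η_n(x) = n^{-1/2} ∑_{i=1}^n ξ_i(x)`. -/
def η (M : MartingaleDifferenceField X P) (n : ℕ) (x : X) (ω : Ω) : ℝ :=
  (Real.sqrt n)⁻¹ * ∑ i ∈ Finset.Icc 1 n, M.ξ i x ω

/-- `σ² = inf_{x ∈ X} sup_{n ≥ 1} n⁻¹ ∑_{k=1}^n Var(ξ_k(x))`, with values in `[0, ∞]`. -/
def sigmaSq (M : MartingaleDifferenceField X P) : ℝ≥0∞ :=
  ⨅ x : X, ⨆ (n : ℕ) (_ : 1 ≤ n), (n : ℝ≥0∞)⁻¹ * ∑ k ∈ Finset.Icc 1 n, evariance (M.ξ k x) P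

/-- The semi-distance `ρ_q(x, y) = sup_{k ≥ 1} ‖ξ_k(x) - ξ_k(y)‖_(q)`. -/
def rho (M : MartingaleDifferenceField X P) (q : ℝ) (x y : X) : ℝ≥0∞ :=
  ⨆ (k : ℕ) (_ : 1 ≤ k), qNorm P q (M.ξ k x - M.ξ k y)

theorem rho_self (M : MartingaleDifferenceField X P) (q : ℝ) (x : X) : M.rho q x x = 0 := by
  simp [rho, qNorm_zero]

theorem rho_comm (M : MartingaleDifferenceField X P) (q : ℝ) (x y : X) :
    M.rho q x y = M.rho q y x := by
  simp only [rho, qNorm_sub_comm P q (M.ξ _ x) (M.ξ _ y)]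

theorem rho_triangle (M : MartingaleDifferenceField X P) (q : ℝ) (x y z : X) :
    M.rho q x z ≤ M.rho q x y + M.rho q y z := by
  refine iSup₂_le fun k hk => ?_
  have hx := (M.integrable k hk x).aestronglyMeasurable
  have hy := (M.integrable k hk y).aestronglyMeasurable
  have hz := (M.integrable k hk z).aestronglyMeasurable
  have h := qNorm_add_le P q (hx.sub hy) (hy.sub hz)
  rw [sub_add_sub_cancel] at h
  exact h.trans (add_le_add
    (le_iSup₂ (f := fun (k : ℕ) (_ : 1 ≤ k) => qNorm P q (M.ξ k x - M.ξ k y)) k hk)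
    (le_iSup₂ (f := fun (k : ℕ) (_ : 1 ≤ k) => qNorm P q (M.ξ k y - M.ξ k z)) k hk))

/-- The diameter `D(ρ_q)` of the set `X` for the semi-distance `ρ_q`. -/
def diam (M : MartingaleDifferenceField X P) (q : ℝ) : ℝ≥0∞ :=
  ⨆ (x : X) (y : X), M.rho q x y

/-- The set `X`, regarded as a semi-metric space with the semi-distance `ρ_q`. -/
def Space (_M : MartingaleDifferenceField X P) (_q : ℝ) : Type u := X

instance (M : MartingaleDifferenceField X P) (q : ℝ) : PseudoEMetricSpace (M.Space q) where
  edist x y := M.rho q x y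
  edist_self x := M.rho_self q x
  edist_comm x y := M.rho_comm q x y
  edist_triangle x y z := M.rho_triangle q x y z

/-- A point of `X`, regarded as a point of `(X, ρ_q)`. -/
def toSpace (M : MartingaleDifferenceField X P) (q : ℝ) (x : X) : M.Space q := x

/-- The space `C(X, ρ_q)` of bounded real functions on `X` continuous for `ρ_q`, with the sup
norm. If `(X, ρ_q)` is compact, these are all continuous functions. -/
abbrev ContFun (M : MartingaleDifferenceField X P) (q : ℝ) : Type u := M.Space q →ᵇ ℝ

instance (M : MartingaleDifferenceField X P) (q : ℝ) : MeasurableSpace (M.ContFun q) :=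
  borel _

instance (M : MartingaleDifferenceField X P) (q : ℝ) : BorelSpace (M.ContFun q) := ⟨rfl⟩

/-- `Z` is a modification of the random field `Y` with all sample paths in `C(X, ρ_q)`. -/
def IsContinuousModification (M : MartingaleDifferenceField X P) (q : ℝ) (Y : X → Ω → ℝ)
    (Z : Ω → M.ContFun q) : Prop :=
  ∀ x : X, ∀ᵐ ω ∂P, Z ω (M.toSpace q x) = Y x ω

/-- The set of the laws on `C(X, ρ_q)` of the random elements `Z 1, Z 2, …`. -/
def laws (M : MartingaleDifferenceField X P) (q : ℝ) (Z : ℕ → Ω → M.ContFun q) :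
    Set (ProbabilityMeasure (M.ContFun q)) :=
  {ν | ∃ n : ℕ, 1 ≤ n ∧ (ν : Measure (M.ContFun q)) = P.map (Z n)}

end MartingaleDifferenceField

end

/-!
Two facts make the theorem true: a moment inequality whose constant grows like `√p`, and a chaining
argument that spends exactly this growth.

*Moments.* If `E[f ^ (2m-1) * g] = 0`, expanding `E(f + g)^(2m)` by the binomial theorem and
applying Hölder's inequality to every term but the vanishing one shows
`‖f + g‖_{2m}² ≤ ‖f‖_{2m}² + 5m ‖g‖_{2m}²` (`lintegral_enorm_add_pow_le`). Iterated along a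
martingale this bounds the `L^{2m}` norm of a normed sum of `n` martingale differences by `√(5m)`
times the largest norm of a summand, uniformly in `n`. Since the increments of `ξ_i` have `L^p` norms
at most `p^{1/q} ρ_q`, those of `η_n` have `L^p` norms at most `3 p^{1/2 + 1/q} ρ_q`
(`MartingaleDifferenceField.lintegral_enorm_η_sub_pow_le`); here `1/2 + 1/q = (2 + q)/(2q)`.

*Chaining.* Along radii `ε_k` halving to `0` take finite `ε_k`-nets with partitions of unity
subordinate to them, and let `I_k f` be the continuous function interpolating the values of `f` on
the `k`-th net. Then `‖I_k f - I_{k+1} f‖` is at most the largest increment of `f` over pairs of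
neighbouring points of two consecutive nets. The expected maximum of at most `e^p` variables is at
most `e` times the largest `L^p` norm, so, with `p` of the order of the entropy,
`E‖I_k η_n - I_{k+1} η_n‖ ≤ const · ε_k (H(ε_{k+1}) + 1)^{1/2 + 1/q}`. The entropy integral says that
this is summable (`nonempty_entropyChain`); hence `I_k η_n` converges almost surely in the sup norm
to a modification of `η_n`, at a rate that does not depend on `n`
(`EntropyChain.exists_modification`). The same holds for each `ξ_i`.

*Tightness.* The maps `I_k` have finite rank, and the values of `η_n` at a point are bounded in `L¹`
uniformly in `n`: at one point because `σ² < ∞`, elsewhere by the moment bound. So up to a small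
probability and a small distance, all the modifications lie in one compact set
(`isTightMeasureSet_map_of_interp`). Two modifications with continuous paths agree on the countable
union of the nets, which is dense, and therefore coincide almost surely; thus the choice of the
modifications is immaterial, and Prokhorov's theorem concludes.
-/

open scoped Topology

/-! ### Moments of sums of martingale differences -/

/-- After subtraction of its linear term, `(a + b) ^ (2m)` is at most `(a² + 5m b²) ^ m`. The
linear term is the one that vanishes in expectation for martingale differences. -/
theorem add_pow_two_mul_le {a b : ℝ} (ha : 0 ≤ a) (hb : 0 ≤ b) {m : ℕ} (hm : 1 ≤ m) :
    (a + b) ^ (2 * m) ≤ 2 * m * (a ^ (2 * m - 1) * b) + (a ^ 2 + 5 * m * b ^ 2) ^ m := by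
  have hm' : (1 : ℝ) ≤ m := by exact_mod_cast hm
  -- If `a ≤ 2mb`, then `2ab ≤ 4m b²`; otherwise `2mb/a ≤ 1` and `exp u ≤ 1 + u + u²` applies.
  rcases le_or_gt a (2 * m * b) with h | h
  · have h1 : (a + b) ^ 2 ≤ a ^ 2 + 5 * m * b ^ 2 := by
      nlinarith [mul_le_mul_of_nonneg_right h hb, mul_nonneg (sub_nonneg.2 hm') (sq_nonneg b)]
    calc (a + b) ^ (2 * m) = ((a + b) ^ 2) ^ m := pow_mul _ _ _
      _ ≤ (a ^ 2 + 5 * m * b ^ 2) ^ m := by gcongr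
      _ ≤ _ := le_add_of_nonneg_left (by positivity)
  · have ha0 : 0 < a := lt_of_le_of_lt (by positivity) h
    obtain ⟨t, rfl⟩ : ∃ t, b = a * t := ⟨b / a, by field_simp⟩
    have ht : 0 ≤ t := nonneg_of_mul_nonneg_right hb ha0
    have hu : 2 * m * t ≤ 1 := by
      by_contra! hc
      nlinarith
    have h1 : (1 + t) ^ (2 * m) ≤ 1 + 2 * m * t + (2 * m * t) ^ 2 := by
      have h2 := Real.abs_exp_sub_one_sub_id_le (x := 2 * m * t)
        (by rw [abs_of_nonneg (by positivity)]; exact hu)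
      have h3 : (1 + t) ^ (2 * m) ≤ Real.exp (2 * m * t) := by
        calc (1 + t) ^ (2 * m) ≤ (Real.exp t) ^ (2 * m) := by
              gcongr
              linarith [Real.add_one_le_exp t]
          _ = _ := by rw [← Real.exp_nat_mul]; push_cast; rfl
      linarith [le_abs_self (Real.exp (2 * m * t) - 1 - 2 * m * t)]
    have h4 : 1 + (m : ℝ) * (5 * m * t ^ 2) ≤ (1 + 5 * m * t ^ 2) ^ m :=
      one_add_mul_le_pow (by nlinarith [mul_nonneg (zero_le_one.trans hm') (sq_nonneg t)]) m
    have h5 : (1 + t) ^ (2 * m) ≤ 2 * m * t + (1 + 5 * m * t ^ 2) ^ m := by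
      nlinarith [sq_nonneg ((m : ℝ) * t)]
    have h6 := mul_le_mul_of_nonneg_left h5 (pow_nonneg ha (2 * m))
    have e1 : a ^ (2 * m) = a ^ (2 * m - 1) * a := by
      rw [← pow_succ]; congr 1; omega
    calc (a + a * t) ^ (2 * m) = a ^ (2 * m) * (1 + t) ^ (2 * m) := by
          rw [← mul_pow]; ring
      _ ≤ a ^ (2 * m) * (2 * m * t + (1 + 5 * m * t ^ 2) ^ m) := h6
      _ = 2 * m * (a ^ (2 * m - 1) * a * t) + (a ^ 2) ^ m * (1 + 5 * m * t ^ 2) ^ m := by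
          rw [← e1, ← pow_mul]; ring
      _ = _ := by rw [← mul_pow]; ring

section Moments

variable {Ω : Type*} {mΩ : MeasurableSpace Ω} {P : Measure Ω}

/-- Hölder's inequality for mixed moments of total order `N`. -/
theorem lintegral_enorm_pow_mul_pow_le {f g : Ω → ℝ} (hf : AEStronglyMeasurable f P)
    (hg : AEStronglyMeasurable g P) {N j k : ℕ} (hN : N ≠ 0) (hjk : j + k = N) {A B : ℝ≥0}
    (hA : ∫⁻ ω, ‖f ω‖ₑ ^ N ∂P ≤ (A : ℝ≥0∞) ^ N) (hB : ∫⁻ ω, ‖g ω‖ₑ ^ N ∂P ≤ (B : ℝ≥0∞) ^ N) :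
    ∫⁻ ω, ‖f ω ^ j * g ω ^ k‖ₑ ∂P ≤ (A : ℝ≥0∞) ^ j * (B : ℝ≥0∞) ^ k := by
  have hN' : (N : ℝ) ≠ 0 := by exact_mod_cast hN
  have key : ∀ (x : ℝ≥0∞) (i : ℕ), (x ^ N) ^ ((i : ℝ) / N) = x ^ i := by
    intro x i
    rw [← ENNReal.rpow_natCast, ← ENNReal.rpow_mul, mul_div_cancel₀ _ hN', ENNReal.rpow_natCast]
  have h := ENNReal.lintegral_mul_norm_pow_le (μ := P) (hf.enorm.pow_const N)
    (hg.enorm.pow_const N) (p := (j : ℝ) / N) (q := (k : ℝ) / N) (by positivity) (by positivity)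
    (by rw [← add_div, ← Nat.cast_add, hjk, div_self hN'])
  simp only [key] at h
  calc ∫⁻ ω, ‖f ω ^ j * g ω ^ k‖ₑ ∂P = ∫⁻ ω, ‖f ω‖ₑ ^ j * ‖g ω‖ₑ ^ k ∂P := by
        simp [enorm_mul, enorm_pow]
    _ ≤ _ := h
    _ ≤ ((A : ℝ≥0∞) ^ N) ^ ((j : ℝ) / N) * ((B : ℝ≥0∞) ^ N) ^ ((k : ℝ) / N) := by
        gcongr
    _ = _ := by rw [key, key]

/-- In terms of norms, `‖f + g‖_{2m}² ≤ ‖f‖_{2m}² + 5m ‖g‖_{2m}²` if `f ^ (2m - 1)` and `g` are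
orthogonal. Integrability of their product follows from the bounds, so it may be used in
verifying the orthogonality. -/
theorem lintegral_enorm_add_pow_le {f g : Ω → ℝ} (hf : AEStronglyMeasurable f P)
    (hg : AEStronglyMeasurable g P) {m : ℕ} (hm : 1 ≤ m) {A B : ℝ≥0}
    (hA : ∫⁻ ω, ‖f ω‖ₑ ^ (2 * m) ∂P ≤ (A : ℝ≥0∞) ^ (2 * m))
    (hB : ∫⁻ ω, ‖g ω‖ₑ ^ (2 * m) ∂P ≤ (B : ℝ≥0∞) ^ (2 * m))
    (h0 : Integrable (fun ω => f ω ^ (2 * m - 1) * g ω) P →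
      ∫ ω, f ω ^ (2 * m - 1) * g ω ∂P = 0) :
    ∫⁻ ω, ‖f ω + g ω‖ₑ ^ (2 * m) ∂P ≤ ((A ^ 2 + 5 * m * B ^ 2 : ℝ≥0) : ℝ≥0∞) ^ m := by
  have hle : ∀ j ∈ Finset.range (2 * m + 1),
      ∫⁻ ω, ‖f ω ^ j * g ω ^ (2 * m - j)‖ₑ ∂P ≤ (A : ℝ≥0∞) ^ j * (B : ℝ≥0∞) ^ (2 * m - j) := by
    intro j hj
    rw [Finset.mem_range] at hj
    exact lintegral_enorm_pow_mul_pow_le hf hg (by omega) (by omega) hA hB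
  have hint : ∀ j ∈ Finset.range (2 * m + 1),
      Integrable (fun ω => f ω ^ j * g ω ^ (2 * m - j)) P := by
    intro j hj
    refine ⟨(hf.pow j).mul (hg.pow _), (hle j hj).trans_lt ?_⟩
    exact ENNReal.mul_lt_top (by simp) (by simp)
  have hre : ∀ j ∈ Finset.range (2 * m + 1),
      ∫ ω, f ω ^ j * g ω ^ (2 * m - j) ∂P ≤ (A : ℝ) ^ j * (B : ℝ) ^ (2 * m - j) := by
    intro j hj
    have h1 := (le_abs_self _).trans (norm_integral_le_lintegral_norm
      (μ := P) (fun ω => f ω ^ j * g ω ^ (2 * m - j)))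
    refine h1.trans ?_
    simp only [ofReal_norm]
    refine ENNReal.toReal_le_of_le_ofReal (by positivity) ((hle j hj).trans_eq ?_)
    rw [ENNReal.ofReal_mul (by positivity), ENNReal.ofReal_pow (by positivity),
      ENNReal.ofReal_pow (by positivity), ENNReal.ofReal_coe_nnreal, ENNReal.ofReal_coe_nnreal]
  have hmem : 2 * m - 1 ∈ Finset.range (2 * m + 1) := by rw [Finset.mem_range]; omega
  have hsub : 2 * m - (2 * m - 1) = 1 := by omega
  have hzero : ∫ ω, f ω ^ (2 * m - 1) * g ω ^ (2 * m - (2 * m - 1)) ∂P = 0 := by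
    have := hint _ hmem
    simp only [hsub, pow_one] at this ⊢
    exact h0 this
  have hexp : ∀ ω, (f ω + g ω) ^ (2 * m)
      = ∑ j ∈ Finset.range (2 * m + 1),
        f ω ^ j * g ω ^ (2 * m - j) * ((2 * m).choose j : ℝ) := fun ω => add_pow _ _ _
  have hI : ∫ ω, (f ω + g ω) ^ (2 * m) ∂P
      = ∑ j ∈ Finset.range (2 * m + 1),
        (∫ ω, f ω ^ j * g ω ^ (2 * m - j) ∂P) * ((2 * m).choose j : ℝ) := by
    simp only [hexp]
    rw [integral_finsetSum _ fun j hj => (hint j hj).mul_const _]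
    simp only [integral_mul_const]
  have hII : Integrable (fun ω => (f ω + g ω) ^ (2 * m)) P := by
    simp only [hexp]
    exact integrable_finsetSum _ fun j hj => (hint j hj).mul_const _
  have hcard : ((2 * m).choose (2 * m - 1) : ℝ) = 2 * m := by
    rw [Nat.choose_symm_of_eq_add (show 2 * m = (2 * m - 1) + 1 by omega), Nat.choose_one_right]
    push_cast; rfl
  have hreal : ∫ ω, (f ω + g ω) ^ (2 * m) ∂P ≤ ((A : ℝ) ^ 2 + 5 * m * (B : ℝ) ^ 2) ^ m := by
    have h2 := add_pow_two_mul_le A.coe_nonneg B.coe_nonneg hm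
    have h3 : ((A : ℝ) + B) ^ (2 * m) = _ := add_pow _ _ _
    rw [← Finset.add_sum_erase _ _ hmem, hcard, hsub, pow_one] at h3
    rw [hI, ← Finset.add_sum_erase _ _ hmem, hzero, zero_mul, zero_add]
    have h4 : ∑ j ∈ (Finset.range (2 * m + 1)).erase (2 * m - 1),
          (∫ ω, f ω ^ j * g ω ^ (2 * m - j) ∂P) * ((2 * m).choose j : ℝ)
        ≤ ∑ j ∈ (Finset.range (2 * m + 1)).erase (2 * m - 1),
          (A : ℝ) ^ j * (B : ℝ) ^ (2 * m - j) * ((2 * m).choose j : ℝ) := by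
      refine Finset.sum_le_sum fun j hj => ?_
      exact mul_le_mul_of_nonneg_right (hre j (Finset.mem_of_mem_erase hj)) (by positivity)
    linarith
  have hnn : ∀ ω, ‖f ω + g ω‖ₑ ^ (2 * m) = ENNReal.ofReal ((f ω + g ω) ^ (2 * m)) := by
    intro ω
    rw [← enorm_pow, Real.enorm_of_nonneg ((even_two_mul m).pow_nonneg _)]
  simp only [hnn]
  rw [← ofReal_integral_eq_lintegral_ofReal hII
    (Eventually.of_forall fun ω => (even_two_mul m).pow_nonneg _)]
  refine (ENNReal.ofReal_le_ofReal hreal).trans_eq ?_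
  rw [ENNReal.ofReal_pow (by positivity), ← ENNReal.ofReal_coe_nnreal]
  push_cast
  rfl

/-- A Burkholder type inequality whose constant grows like `√m` only: a sum of martingale
differences satisfies `‖∑ d_i‖_{2m}² ≤ 5m ∑ ‖d_i‖_{2m}²`. -/
theorem lintegral_enorm_sum_pow_le [IsFiniteMeasure P] (F : Filtration ℕ mΩ) {d : ℕ → Ω → ℝ}
    (hF : ∀ i, 1 ≤ i → AEStronglyMeasurable[F i] (d i) P)
    (hint : ∀ i, 1 ≤ i → Integrable (d i) P)
    (h0 : ∀ i, P[d (i + 1) | F i] =ᵐ[P] 0) {m : ℕ} (hm : 1 ≤ m) (b : ℕ → ℝ≥0)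
    (hb : ∀ i, 1 ≤ i → ∫⁻ ω, ‖d i ω‖ₑ ^ (2 * m) ∂P ≤ (b i : ℝ≥0∞) ^ (2 * m)) (n : ℕ) :
    ∫⁻ ω, ‖∑ i ∈ Finset.Icc 1 n, d i ω‖ₑ ^ (2 * m) ∂P
      ≤ ((5 * m * ∑ i ∈ Finset.Icc 1 n, b i ^ 2 : ℝ≥0) : ℝ≥0∞) ^ m := by
  induction n with
  | zero => simp [show m ≠ 0 by omega]
  | succ n ih =>
    set S : Ω → ℝ := fun ω => ∑ i ∈ Finset.Icc 1 n, d i ω with hS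
    set A : ℝ≥0 := NNReal.sqrt (5 * m * ∑ i ∈ Finset.Icc 1 n, b i ^ 2) with hAdef
    have hA2 : A ^ 2 = 5 * m * ∑ i ∈ Finset.Icc 1 n, b i ^ 2 := NNReal.sq_sqrt _
    have hSF : AEStronglyMeasurable[F n] S P := by
      have hSd : S = ∑ i ∈ Finset.Icc 1 n, d i := by ext ω; simp [hS]
      rw [hSd]
      refine Finset.sum_induction d (fun f => AEStronglyMeasurable[F n] f P)
        (fun _ _ h h' => h.add h') aestronglyMeasurable_const fun i hi => ?_
      rw [Finset.mem_Icc] at hi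
      exact (hF i hi.1).mono (F.mono hi.2)
    have hSm : AEStronglyMeasurable S P := hSF.mono (F.le n)
    have hA : ∫⁻ ω, ‖S ω‖ₑ ^ (2 * m) ∂P ≤ (A : ℝ≥0∞) ^ (2 * m) := by
      rw [pow_mul (A : ℝ≥0∞), ← ENNReal.coe_pow A 2, hA2]
      exact ih
    have hstep := lintegral_enorm_add_pow_le hSm (hint (n + 1) (by omega)).aestronglyMeasurable hm
      hA (hb (n + 1) (by omega)) ?_
    · simp only [Finset.sum_Icc_succ_top (show 1 ≤ n + 1 by omega)]
      refine hstep.trans_eq ?_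
      rw [hA2, mul_add]
    · intro hi
      -- `S ^ (2m - 1)` is measurable for the past and `d (n + 1)` is centered given the past.
      have h1 : P[fun ω => S ω ^ (2 * m - 1) * d (n + 1) ω | F n] =ᵐ[P]
          (fun ω => S ω ^ (2 * m - 1)) * P[d (n + 1) | F n] :=
        condExp_mul_of_aestronglyMeasurable_left (hSF.pow _) hi (hint (n + 1) (by omega))
      rw [← integral_condExp (F.le n), integral_congr_ae h1]
      refine integral_eq_zero_of_ae ?_
      filter_upwards [h0 n] with ω hω
      simp [hω]

end Moments

/-! ### Partitions of unity and interpolation -/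

section Interpolation

variable {X : Type*} [PseudoEMetricSpace X]

/-- The functions `w y`, `y ∈ s`, form a continuous partition of unity on `X`, where `w y` vanishes
outside the closed ball of radius `r` about `y`. Indices outside `s` do not contribute to
`interp s w`. -/
structure IsPartitionOfUnity (s : Finset X) (r : ℝ≥0) (w : X → X →ᵇ ℝ) : Prop where
  nonneg : ∀ y x, 0 ≤ w y x
  sum_eq_one : ∀ x, ∑ y ∈ s, w y x = 1
  edist_le : ∀ y x, w y x ≠ 0 → edist x y ≤ r

theorem exists_isPartitionOfUnity {s : Finset X} {ε : ℝ≥0} (hε : 0 < ε)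
    (hs : ∀ x, ∃ y ∈ s, edist x y ≤ ε) :
    ∃ w : X → X →ᵇ ℝ, IsPartitionOfUnity s (2 * ε) w := by
  classical
  -- The subtraction is truncated, so `g y` vanishes outside the ball of radius `2ε` about `y`; it is
  -- finite and continuous even where the distance is infinite.
  set g : X → X → ℝ := fun y x => (((2 * ε : ℝ≥0) : ℝ≥0∞) - edist x y).toReal with hg
  have hg0 : ∀ y x, 0 ≤ g y x := fun y x => ENNReal.toReal_nonneg
  have hgc : ∀ y, Continuous (g y) := by
    intro y
    have h1 : Continuous fun x : X => ((2 * ε : ℝ≥0) : ℝ≥0∞) - edist x y :=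
      (ENNReal.continuous_sub_left ENNReal.coe_ne_top).comp (continuous_id.edist continuous_const)
    exact ENNReal.continuousOn_toReal.comp_continuous h1 fun x =>
      ENNReal.sub_ne_top ENNReal.coe_ne_top
  have hpos : ∀ x, 0 < ∑ y ∈ s, g y x := by
    intro x
    obtain ⟨y, hy, hxy⟩ := hs x
    refine Finset.sum_pos' (fun y _ => hg0 y x) ⟨y, hy, ?_⟩
    refine ENNReal.toReal_pos ?_ (ENNReal.sub_ne_top ENNReal.coe_ne_top)
    refine (tsub_pos_of_lt (hxy.trans_lt ?_)).ne'
    rw [ENNReal.coe_lt_coe, two_mul]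
    exact lt_add_of_pos_left _ hε
  have hle : ∀ y ∈ s, ∀ x, g y x ≤ ∑ z ∈ s, g z x := fun y hy x =>
    Finset.single_le_sum (f := fun z => g z x) (fun z _ => hg0 z x) hy
  have hcont : ∀ y, Continuous fun x => g y x / ∑ z ∈ s, g z x := fun y =>
    (hgc y).div (continuous_finsetSum _ fun z _ => hgc z) fun x => (hpos x).ne'
  refine ⟨fun y => if hy : y ∈ s then
    BoundedContinuousFunction.ofNormedAddCommGroup (fun x => g y x / ∑ z ∈ s, g z x)
      (hcont y) 1 (fun x => ?_) else 0, ?_, ?_, ?_⟩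
  · rw [Real.norm_of_nonneg (div_nonneg (hg0 y x) (hpos x).le), div_le_one (hpos x)]
    exact hle y hy x
  · intro y x
    by_cases hy : y ∈ s
    · simpa [hy] using div_nonneg (hg0 y x) (hpos x).le
    · simp [hy]
  · intro x
    rw [Finset.sum_congr rfl (g := fun y => g y x / ∑ z ∈ s, g z x)
      (fun y hy => by simp [hy]), ← Finset.sum_div, div_self (hpos x).ne']
  · intro y x hx
    by_contra! hc
    refine hx ?_
    have : g y x = 0 := by simp only [hg, tsub_eq_zero_of_le hc.le, ENNReal.toReal_zero]
    by_cases hy : y ∈ s <;> simp [hy, this]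

/-- The interpolation `∑ y ∈ s, f y • w y` of the values of `f` at the points of `s`. -/
noncomputable def interp (s : Finset X) (w : X → X →ᵇ ℝ) (f : X → ℝ) : X →ᵇ ℝ :=
  ∑ y ∈ s, f y • w y

theorem interp_apply (s : Finset X) (w : X → X →ᵇ ℝ) (f : X → ℝ) (x : X) :
    interp s w f x = ∑ y ∈ s, f y * w y x := by
  simp [interp]

theorem continuous_interp (s : Finset X) (w : X → X →ᵇ ℝ) : Continuous (interp s w) :=
  continuous_finsetSum _ fun y _ => (continuous_apply y).smul continuous_const

theorem aestronglyMeasurable_interp {Ω : Type*} [MeasurableSpace Ω] {P : Measure Ω}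
    {Y : X → Ω → ℝ} (hY : ∀ x, AEStronglyMeasurable (Y x) P) (s : Finset X) (w : X → X →ᵇ ℝ) :
    AEStronglyMeasurable (fun ω => interp s w fun x => Y x ω) P :=
  Finset.aestronglyMeasurable_fun_sum _ fun y _ => (hY y).smul_const _

namespace IsPartitionOfUnity

variable {s t : Finset X} {r r' : ℝ≥0} {w v : X → X →ᵇ ℝ}

theorem interp_sub (hw : IsPartitionOfUnity s r w) (f : X → ℝ) (x : X) :
    interp s w f x - f x = ∑ y ∈ s, w y x * (f y - f x) := by
  simp only [interp_apply, mul_sub, Finset.sum_sub_distrib, ← Finset.sum_mul, hw.sum_eq_one x,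
    one_mul, mul_comm (f _)]

/-- Two interpolations of `f` differ by an average of increments of `f` over pairs of points, one
from each net, that are close to a common point. -/
theorem enorm_interp_sub_interp_le (hw : IsPartitionOfUnity s r w) (hv : IsPartitionOfUnity t r' v)
    (f : X → ℝ) :
    ‖interp s w f - interp t v f‖ₑ ≤
      ((s ×ˢ t).filter fun p => edist p.1 p.2 ≤ r + r').sup fun p => ‖f p.1 - f p.2‖ₑ := by
  set T := (s ×ˢ t).filter fun p => edist p.1 p.2 ≤ r + r' with hT
  set B := T.sup fun p => ‖f p.1 - f p.2‖ₑ with hB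
  have hBtop : B ≠ ∞ := by
    refine ((Finset.sup_lt_iff (by simp)).2 fun p _ => ?_).ne
    exact enorm_lt_top
  have hle : ∀ p ∈ T, |f p.1 - f p.2| ≤ B.toReal := by
    intro p hp
    have h1 : ‖f p.1 - f p.2‖ₑ ≤ B := Finset.le_sup (f := fun p : X × X => ‖f p.1 - f p.2‖ₑ) hp
    have h2 := ENNReal.toReal_mono hBtop h1
    rwa [toReal_enorm, Real.norm_eq_abs] at h2
  have hnorm : ‖interp s w f - interp t v f‖ ≤ B.toReal := by
    refine (BoundedContinuousFunction.norm_le ENNReal.toReal_nonneg).2 fun x => ?_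
    -- Each of the two sums may be averaged over the other partition of unity.
    have e1 : (interp s w f - interp t v f) x
        = ∑ y ∈ s, ∑ z ∈ t, w y x * v z x * (f y - f z) := by
      have e2 : ∀ y ∈ s, ∑ z ∈ t, w y x * v z x * (f y - f z)
          = w y x * (f y - ∑ z ∈ t, f z * v z x) := by
        intro y _
        calc ∑ z ∈ t, w y x * v z x * (f y - f z)
            = w y x * (f y * ∑ z ∈ t, v z x - ∑ z ∈ t, f z * v z x) := by
              rw [Finset.mul_sum, ← Finset.sum_sub_distrib, Finset.mul_sum]
              exact Finset.sum_congr rfl fun z _ => by ring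
          _ = _ := by rw [hv.sum_eq_one, mul_one]
      rw [Finset.sum_congr rfl e2]
      simp only [BoundedContinuousFunction.coe_sub, Pi.sub_apply, interp_apply, mul_sub,
        Finset.sum_sub_distrib, ← Finset.sum_mul, hw.sum_eq_one x, one_mul, mul_comm (f _)]
    rw [e1, Real.norm_eq_abs]
    calc |∑ y ∈ s, ∑ z ∈ t, w y x * v z x * (f y - f z)|
        ≤ ∑ y ∈ s, ∑ z ∈ t, |w y x * v z x * (f y - f z)| :=
          (Finset.abs_sum_le_sum_abs _ _).trans
            (Finset.sum_le_sum fun y _ => Finset.abs_sum_le_sum_abs _ _)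
      _ ≤ ∑ y ∈ s, ∑ z ∈ t, w y x * v z x * B.toReal := by
          refine Finset.sum_le_sum fun y hy => Finset.sum_le_sum fun z hz => ?_
          have hwv : 0 ≤ w y x * v z x := mul_nonneg (hw.nonneg y x) (hv.nonneg z x)
          rw [abs_mul, abs_of_nonneg hwv]
          rcases hwv.eq_or_lt with h0 | h0
          · simp [← h0]
          · refine mul_le_mul_of_nonneg_left (hle (y, z) ?_) hwv
            have hw0 : w y x ≠ 0 := fun h => by simp [h] at h0
            have hv0 : v z x ≠ 0 := fun h => by simp [h] at h0
            rw [hT, Finset.mem_filter]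
            refine ⟨Finset.mk_mem_product hy hz, (edist_triangle_left y z x).trans ?_⟩
            exact add_le_add (hw.edist_le y x hw0) (hv.edist_le z x hv0)
      _ = B.toReal := by
          simp only [mul_assoc, ← Finset.mul_sum, ← Finset.sum_mul, hv.sum_eq_one, hw.sum_eq_one,
            one_mul]
  rw [← ENNReal.ofReal_toReal hBtop, ← ofReal_norm]
  exact ENNReal.ofReal_le_ofReal hnorm

theorem lintegral_enorm_interp_sub_le {Ω : Type*} [MeasurableSpace Ω] {P : Measure Ω}
    {Y : X → Ω → ℝ} (hY : ∀ x, AEStronglyMeasurable (Y x) P) (hw : IsPartitionOfUnity s r w)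
    {K : ℝ≥0∞} (hK : ∀ x y, ∫⁻ ω, ‖Y x ω - Y y ω‖ₑ ∂P ≤ K * edist x y) (x : X) :
    ∫⁻ ω, ‖(interp s w fun x => Y x ω) x - Y x ω‖ₑ ∂P ≤ K * r := by
  have h1 : ∀ ω, ‖(interp s w fun x => Y x ω) x - Y x ω‖ₑ
      ≤ ∑ y ∈ s, ENNReal.ofReal (w y x) * ‖Y y ω - Y x ω‖ₑ := by
    intro ω
    rw [hw.interp_sub]
    refine (enorm_sum_le _ _).trans (Finset.sum_le_sum fun y _ => ?_)
    rw [enorm_mul, Real.enorm_of_nonneg (hw.nonneg y x)]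
  have hm : ∀ y, AEMeasurable (fun ω => ‖Y y ω - Y x ω‖ₑ) P := fun y => ((hY y).sub (hY x)).enorm
  calc ∫⁻ ω, ‖(interp s w fun x => Y x ω) x - Y x ω‖ₑ ∂P
      ≤ ∫⁻ ω, ∑ y ∈ s, ENNReal.ofReal (w y x) * ‖Y y ω - Y x ω‖ₑ ∂P := lintegral_mono h1
    _ = ∑ y ∈ s, ENNReal.ofReal (w y x) * ∫⁻ ω, ‖Y y ω - Y x ω‖ₑ ∂P := by
        rw [lintegral_finsetSum' _ fun y _ => (hm y).const_mul _]
        exact Finset.sum_congr rfl fun y _ => lintegral_const_mul'' _ (hm y)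
    _ ≤ ∑ y ∈ s, ENNReal.ofReal (w y x) * (K * r) := by
        refine Finset.sum_le_sum fun y _ => ?_
        rcases eq_or_ne (w y x) 0 with h0 | h0
        · simp [h0]
        · gcongr
          refine (hK y x).trans ?_
          gcongr
          rw [edist_comm]
          exact hw.edist_le y x h0
    _ = K * r := by
        rw [← Finset.sum_mul, ← ENNReal.ofReal_sum_of_nonneg fun y _ => hw.nonneg y x,
          hw.sum_eq_one, ENNReal.ofReal_one, one_mul]

end IsPartitionOfUnity

end Interpolation

/-! ### Maxima of finitely many random variables -/

section Maximal

variable {Ω : Type*} [MeasurableSpace Ω] {P : Measure Ω} [IsProbabilityMeasure P]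

/-- Jensen's inequality for the `N`-th power. -/
theorem lintegral_le_of_lintegral_pow_le {f : Ω → ℝ≥0∞} (hf : AEMeasurable f P) {N : ℕ}
    (hN : N ≠ 0) {b : ℝ≥0∞} (hb : ∫⁻ ω, f ω ^ N ∂P ≤ b ^ N) : ∫⁻ ω, f ω ∂P ≤ b := by
  have hN1 : (1 : ℝ) ≤ N := by exact_mod_cast Nat.one_le_iff_ne_zero.2 hN
  have h := ENNReal.lintegral_mul_norm_pow_le (μ := P) (hf.pow_const N)
    (aemeasurable_const (b := (1 : ℝ≥0∞))) (p := (N : ℝ)⁻¹) (q := 1 - (N : ℝ)⁻¹) (by positivity)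
    (by rw [sub_nonneg]; exact inv_le_one_of_one_le₀ hN1) (by ring)
  simp only [ENNReal.one_rpow, mul_one, lintegral_const, measure_univ,
    ENNReal.pow_rpow_inv_natCast hN] at h
  refine h.trans ((ENNReal.rpow_le_rpow hb (by positivity)).trans_eq ?_)
  rw [ENNReal.pow_rpow_inv_natCast hN]

/-- The expected maximum of at most `e ^ N` random variables is at most `e` times the largest of
their `L^N` norms. -/
theorem lintegral_sup_enorm_le {ι : Type*} (T : Finset ι) {g : ι → Ω → ℝ}
    (hg : ∀ i, AEStronglyMeasurable (g i) P) {N : ℕ} (hN : N ≠ 0) {b : ℝ≥0∞}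
    (hb : ∀ i ∈ T, ∫⁻ ω, ‖g i ω‖ₑ ^ N ∂P ≤ b ^ N) (hT : (T.card : ℝ) ≤ Real.exp N) :
    ∫⁻ ω, T.sup (fun i => ‖g i ω‖ₑ) ∂P ≤ ENNReal.ofReal (Real.exp 1) * b := by
  have hm : AEMeasurable (fun ω => T.sup fun i => ‖g i ω‖ₑ) P := by
    have := Finset.sup_induction (s := T) (f := fun i ω => ‖g i ω‖ₑ)
      (p := fun f => AEMeasurable f P) aemeasurable_const (fun _ h _ h' => h.sup h')
      fun i _ => (hg i).enorm
    convert! this using 1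
    ext ω
    exact (Finset.sup_apply T (fun i ω => ‖g i ω‖ₑ) ω).symm
  refine lintegral_le_of_lintegral_pow_le hm hN ?_
  calc ∫⁻ ω, T.sup (fun i => ‖g i ω‖ₑ) ^ N ∂P ≤ ∫⁻ ω, ∑ i ∈ T, ‖g i ω‖ₑ ^ N ∂P := by
        refine lintegral_mono fun ω => ?_
        rcases T.eq_empty_or_nonempty with rfl | hne
        · simp [hN]
        · obtain ⟨i, hi, he⟩ := Finset.exists_mem_eq_sup T hne fun i => ‖g i ω‖ₑ
          rw [he]
          exact Finset.single_le_sum (f := fun i => ‖g i ω‖ₑ ^ N) (fun _ _ => zero_le) hi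
    _ = ∑ i ∈ T, ∫⁻ ω, ‖g i ω‖ₑ ^ N ∂P :=
        lintegral_finsetSum' _ fun i _ => (hg i).enorm.pow_const N
    _ ≤ ∑ _i ∈ T, b ^ N := Finset.sum_le_sum hb
    _ = ENNReal.ofReal T.card * b ^ N := by simp
    _ ≤ ENNReal.ofReal (Real.exp N) * b ^ N := by gcongr
    _ = _ := by
        rw [mul_pow, ← ENNReal.ofReal_pow (Real.exp_pos _).le, ← Real.exp_nat_mul, mul_one]

end Maximal

/-! ### Convergence of interpolated random fields -/

section Chaining

variable {X : Type*} [PseudoEMetricSpace X] {Ω : Type*} [MeasurableSpace Ω] {P : Measure Ω}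
  {s : ℕ → Finset X} {r : ℕ → ℝ≥0} {w : ℕ → X → X →ᵇ ℝ}

/-- If the interpolations of a random field on finer and finer nets have summable `L¹` increments in
the sup norm, then they converge almost surely to a modification of the field. The bound on the
rate of convergence depends on the increments only. -/
theorem exists_continuous_modification
    (hw : ∀ k, IsPartitionOfUnity (s k) (r k) (w k)) (hr : Tendsto r atTop (𝓝 0))
    {Y : X → Ω → ℝ} (hY : ∀ x, AEStronglyMeasurable (Y x) P) {K : ℝ≥0∞} (hKtop : K ≠ ∞)
    (hK : ∀ x y, ∫⁻ ω, ‖Y x ω - Y y ω‖ₑ ∂P ≤ K * edist x y) {a : ℕ → ℝ≥0∞}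
    (ha : ∑' k, a k ≠ ∞)
    (hYa : ∀ k, ∫⁻ ω, ‖(interp (s k) (w k) fun x => Y x ω)
      - interp (s (k + 1)) (w (k + 1)) fun x => Y x ω‖ₑ ∂P ≤ a k) :
    ∃ Z : Ω → X →ᵇ ℝ, AEStronglyMeasurable Z P ∧ (∀ x, ∀ᵐ ω ∂P, Z ω x = Y x ω) ∧
      ∀ k, ∫⁻ ω, ‖Z ω - interp (s k) (w k) fun x => Y x ω‖ₑ ∂P ≤ ∑' l, a (k + l) := by
  classical
  set I : ℕ → Ω → X →ᵇ ℝ := fun k ω => interp (s k) (w k) fun x => Y x ω with hI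
  have hIm : ∀ k, AEStronglyMeasurable (I k) P := fun k => aestronglyMeasurable_interp hY _ _
  have hDm : ∀ k, AEMeasurable (fun ω => ‖I k ω - I (k + 1) ω‖ₑ) P := fun k =>
    ((hIm k).sub (hIm (k + 1))).enorm
  have hfin : ∀ᵐ ω ∂P, ∑' k, ‖I k ω - I (k + 1) ω‖ₑ < ∞ := by
    refine ae_lt_top' (AEMeasurable.tsum hDm) ?_
    rw [lintegral_tsum hDm]
    exact ((ENNReal.tsum_le_tsum hYa).trans_lt (lt_top_iff_ne_top.2 ha)).ne
  have hlim : ∀ᵐ ω ∂P, ∃ z, Tendsto (fun k => I k ω) atTop (𝓝 z) := by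
    filter_upwards [hfin] with ω hω
    refine cauchySeq_tendsto_of_complete (cauchySeq_of_edist_le_of_tsum_ne_top
      (fun k => ‖I k ω - I (k + 1) ω‖ₑ) (fun k => ?_) hω.ne)
    rw [edist_eq_enorm_sub]
  set Z : Ω → X →ᵇ ℝ := fun ω =>
    if h : ∃ z, Tendsto (fun k => I k ω) atTop (𝓝 z) then h.choose else 0 with hZ
  have hZlim : ∀ᵐ ω ∂P, Tendsto (fun k => I k ω) atTop (𝓝 (Z ω)) := by
    filter_upwards [hlim] with ω hω
    simp only [hZ, dif_pos hω]
    exact hω.choose_spec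
  have hZm : AEStronglyMeasurable Z P := aestronglyMeasurable_of_tendsto_ae atTop hIm hZlim
  have hZI : ∀ k, ∫⁻ ω, ‖Z ω - I k ω‖ₑ ∂P ≤ ∑' l, a (k + l) := by
    intro k
    calc ∫⁻ ω, ‖Z ω - I k ω‖ₑ ∂P ≤ ∫⁻ ω, ∑' l, ‖I (k + l) ω - I (k + l + 1) ω‖ₑ ∂P := by
          refine lintegral_mono_ae ?_
          filter_upwards [hZlim] with ω hω
          rw [← edist_eq_enorm_sub, edist_comm]
          exact edist_le_tsum_of_edist_le_of_tendsto
            (fun k => ‖I k ω - I (k + 1) ω‖ₑ) (fun k => (edist_eq_enorm_sub _ _).le) hω k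
      _ = ∑' l, ∫⁻ ω, ‖I (k + l) ω - I (k + l + 1) ω‖ₑ ∂P := lintegral_tsum fun l => hDm (k + l)
      _ ≤ _ := ENNReal.tsum_le_tsum fun l => hYa (k + l)
  refine ⟨Z, hZm, fun x => ?_, hZI⟩
  have hZx : AEStronglyMeasurable (fun ω => Z ω x) P :=
    (continuous_eval_const (F := X →ᵇ ℝ) x).comp_aestronglyMeasurable hZm
  have hbd : ∀ k, ∫⁻ ω, ‖Z ω x - Y x ω‖ₑ ∂P ≤ ∑' l, a (k + l) + K * r k := by
    intro k
    calc ∫⁻ ω, ‖Z ω x - Y x ω‖ₑ ∂P ≤ ∫⁻ ω, ‖Z ω - I k ω‖ₑ + ‖I k ω x - Y x ω‖ₑ ∂P := by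
          refine lintegral_mono fun ω => ?_
          rw [← sub_add_sub_cancel (Z ω x) (I k ω x) (Y x ω)]
          refine (enorm_add_le _ _).trans (add_le_add_left ?_ _)
          exact enorm_le_iff_norm_le.2 ((Z ω - I k ω).norm_coe_le_norm x)
      _ = ∫⁻ ω, ‖Z ω - I k ω‖ₑ ∂P + ∫⁻ ω, ‖I k ω x - Y x ω‖ₑ ∂P :=
          lintegral_add_left' (hZm.sub (hIm k)).enorm _
      _ ≤ _ := add_le_add (hZI k) ((hw k).lintegral_enorm_interp_sub_le hY hK x)
  -- Pointwise the interpolations converge in `L¹` both to `Z` and to `Y`.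
  have h0 : Tendsto (fun k => ∑' l, a (k + l) + K * r k) atTop (𝓝 0) := by
    have h1 : Tendsto (fun k => ∑' l, a (k + l)) atTop (𝓝 0) := by
      simpa only [add_comm] using ENNReal.tendsto_sum_nat_add a ha
    have h2 : Tendsto (fun k => K * (r k : ℝ≥0∞)) atTop (𝓝 (K * (0 : ℝ≥0))) :=
      ENNReal.Tendsto.const_mul (ENNReal.tendsto_coe.2 hr) (Or.inr hKtop)
    simpa using h1.add h2
  have hzero : ∫⁻ ω, ‖Z ω x - Y x ω‖ₑ ∂P = 0 :=
    le_antisymm (ge_of_tendsto' h0 hbd) zero_le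
  have hm : AEMeasurable (fun ω => ‖Z ω x - Y x ω‖ₑ) P := (hZx.sub (hY x)).enorm
  rw [lintegral_eq_zero_iff' hm] at hzero
  filter_upwards [hzero] with ω hω
  simpa [sub_eq_zero] using hω

end Chaining

/-! ### Tightness in the space of bounded continuous functions -/

section Tightness

/-- Measures on a complete space are uniformly tight if, up to a small mass, they live near a common
compact set. -/
theorem isTightMeasureSet_of_infEDist {E : Type*} [PseudoEMetricSpace E] [CompleteSpace E]
    [MeasurableSpace E] {S : Set (Measure E)}
    (h : ∀ δ : ℝ≥0∞, 0 < δ → ∃ K : Set E, IsCompact K ∧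
      ∀ ν ∈ S, ν {z | δ < Metric.infEDist z K} ≤ δ) : IsTightMeasureSet S := by
  rw [isTightMeasureSet_iff_exists_isCompact_measure_compl_le]
  intro ε hε
  obtain ⟨δ, hδ, hsum⟩ := ENNReal.exists_pos_sum_of_countable' hε.ne' ℕ
  choose K hK hKS using fun l => h (δ l) (hδ l)
  have hδ0 : Tendsto δ atTop (𝓝 0) := ENNReal.tendsto_atTop_zero_of_tsum_ne_top hsum.ne_top
  refine ⟨⋂ l, {z | Metric.infEDist z (K l) ≤ δ l}, ?_, fun ν hν => ?_⟩
  · refine TotallyBounded.isCompact_of_isClosed ?_ (isClosed_iInter fun l =>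
      isClosed_le Metric.continuous_infEDist continuous_const)
    refine EMetric.totallyBounded_iff.2 fun η hη => ?_
    have hη2 : 0 < η / 2 := ENNReal.half_pos hη.ne'
    obtain ⟨l, hl⟩ := (hδ0.eventually (gt_mem_nhds hη2)).exists
    obtain ⟨t, htf, ht⟩ := EMetric.totallyBounded_iff.1 (hK l).totallyBounded (η / 2) hη2
    refine ⟨t, htf, fun z hz => ?_⟩
    have hz' : Metric.infEDist z (K l) < η / 2 := (mem_iInter.1 hz l).trans_lt hl
    obtain ⟨y, hy, hzy⟩ := Metric.infEDist_lt_iff.1 hz'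
    obtain ⟨c, hc, hyc⟩ := mem_iUnion₂.1 (ht hy)
    refine mem_iUnion₂.2 ⟨c, hc, ?_⟩
    calc edist z c ≤ edist z y + edist y c := edist_triangle _ _ _
      _ < η / 2 + η / 2 := ENNReal.add_lt_add hzy hyc
      _ = η := ENNReal.add_halves η
  · rw [compl_iInter]
    refine (measure_iUnion_le _).trans ((ENNReal.tsum_le_tsum fun l => ?_).trans hsum.le)
    refine le_trans (measure_mono fun z hz => ?_) (hKS l ν hν)
    simpa using hz

variable {X : Type*} [PseudoEMetricSpace X] {Ω : Type*} [MeasurableSpace Ω] {P : Measure Ω}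
  {s : ℕ → Finset X} {w : ℕ → X → X →ᵇ ℝ}

/-- Random elements of `X →ᵇ ℝ` that are uniformly close in `L¹` to interpolations of random fields
with pointwise bounded first moments have a tight set of laws. -/
theorem isTightMeasureSet_map_of_interp [MeasurableSpace (X →ᵇ ℝ)] [BorelSpace (X →ᵇ ℝ)]
    {ι : Type*} {Y : ι → X → Ω → ℝ} (hY : ∀ i x, AEStronglyMeasurable (Y i x) P)
    {C : X → ℝ≥0∞} (hCtop : ∀ x, C x ≠ ∞) (hC : ∀ i x, ∫⁻ ω, ‖Y i x ω‖ₑ ∂P ≤ C x)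
    {Z : ι → Ω → X →ᵇ ℝ} (hZ : ∀ i, AEStronglyMeasurable (Z i) P) {τ : ℕ → ℝ≥0∞}
    (hτ : Tendsto τ atTop (𝓝 0))
    (hZτ : ∀ i k, ∫⁻ ω, ‖Z i ω - interp (s k) (w k) fun x => Y i x ω‖ₑ ∂P ≤ τ k) :
    IsTightMeasureSet (range fun i => P.map (Z i)) := by
  refine isTightMeasureSet_of_infEDist fun δ hδ => ?_
  wlog hδtop : δ ≠ ∞ generalizing δ
  · obtain ⟨K, hK, hKS⟩ := this 1 one_pos ENNReal.one_ne_top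
    rw [not_not] at hδtop
    exact ⟨K, hK, fun ν hν => hδtop ▸ le_top⟩
  have hδ2 : 0 < δ / 2 := ENNReal.half_pos hδ.ne'
  obtain ⟨k, hk⟩ := (hτ.eventually (gt_mem_nhds (ENNReal.mul_pos hδ.ne' hδ2.ne'))).exists
  set B : ℝ≥0∞ := ∑ x ∈ s k, C x with hB
  have hBtop : B ≠ ∞ := ENNReal.sum_ne_top.2 fun x _ => hCtop x
  obtain ⟨R, hR⟩ : ∃ R : ℝ≥0, B / (δ / 2) < R :=
    ENNReal.lt_iff_exists_nnreal_btwn.1 (ENNReal.div_lt_top hBtop hδ2.ne') |>.imp fun _ h => h.1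
  have hR0 : (R : ℝ≥0∞) ≠ 0 := (zero_le.trans_lt hR).ne'
  refine ⟨interp (s k) (w k) '' univ.pi fun _ => Icc (-(R : ℝ)) R,
    (isCompact_univ_pi fun _ => isCompact_Icc).image (continuous_interp _ _), ?_⟩
  rintro _ ⟨i, rfl⟩
  set I : Ω → X →ᵇ ℝ := fun ω => interp (s k) (w k) fun x => Y i x ω with hI
  have hIm : AEStronglyMeasurable I P := aestronglyMeasurable_interp (hY i) _ _
  have hmeas : MeasurableSet {z : X →ᵇ ℝ | δ < Metric.infEDist z
      (interp (s k) (w k) '' univ.pi fun _ => Icc (-(R : ℝ)) R)} :=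
    (isOpen_lt continuous_const Metric.continuous_infEDist).measurableSet
  change P.map (Z i) _ ≤ δ
  rw [Measure.map_apply_of_aemeasurable (hZ i).aemeasurable hmeas]
  have hsub : Z i ⁻¹' {z : X →ᵇ ℝ | δ < Metric.infEDist z
        (interp (s k) (w k) '' univ.pi fun _ => Icc (-(R : ℝ)) R)} ⊆
      {ω | δ ≤ ‖Z i ω - I ω‖ₑ} ∪ {ω | (R : ℝ≥0∞) ≤ ∑ x ∈ s k, ‖Y i x ω‖ₑ} := by
    intro ω hω
    by_contra! hc
    simp only [mem_union, mem_ofPred_eq, not_or, not_le] at hc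
    refine absurd hω (not_lt.2 (le_trans (Metric.infEDist_le_edist_of_mem (y := I ω) ?_) ?_))
    -- Only the values on the net matter, where the truncation at `±R` changes nothing.
    · refine ⟨fun x => max (-(R : ℝ)) (min R (Y i x ω)), fun x _ =>
        ⟨le_max_left _ _, max_le (by linarith [R.coe_nonneg]) (min_le_left _ _)⟩, ?_⟩
      refine Finset.sum_congr rfl fun x hx => ?_
      have h1 : ‖Y i x ω‖ₑ ≤ R :=
        (Finset.single_le_sum (f := fun x => ‖Y i x ω‖ₑ) (fun _ _ => zero_le) hx).trans hc.2.le
      have h2 : |Y i x ω| ≤ R := by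
        rw [← Real.norm_eq_abs]
        exact_mod_cast enorm_le_coe.1 h1
      beta_reduce
      rw [min_eq_right (abs_le.1 h2).2, max_eq_right (abs_le.1 h2).1]
    · rw [edist_eq_enorm_sub]
      exact hc.1.le
  refine (measure_mono hsub).trans ((measure_union_le _ _).trans ?_)
  rw [← ENNReal.add_halves δ]
  refine add_le_add ?_ ?_
  · rw [ENNReal.add_halves]
    refine (meas_ge_le_lintegral_div ((hZ i).sub hIm).enorm hδ.ne' hδtop).trans ?_
    refine ENNReal.div_le_of_le_mul ?_
    rw [mul_comm]
    exact (hZτ i k).trans hk.le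
  · refine (meas_ge_le_lintegral_div (Finset.aemeasurable_fun_sum _ fun x _ => (hY i x).enorm) hR0
      ENNReal.coe_ne_top).trans ?_
    rw [lintegral_finsetSum' _ fun x _ => (hY i x).enorm]
    refine ENNReal.div_le_of_le_mul ?_
    refine (Finset.sum_le_sum fun x _ => hC i x).trans ?_
    have := (ENNReal.div_le_iff hδ2.ne'
      (by simpa using ENNReal.div_ne_top hδtop two_ne_zero)).1 hR.le
    rwa [mul_comm] at this

end Tightness

/-! ### From the entropy integral to chaining -/

section Entropy

/-- Comparison of the integral of a decreasing function with its lower dyadic sums. -/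
theorem tsum_dyadic_mul_le_lintegral {g : ℝ → ℝ≥0∞} (hg : AntitoneOn g (Ioi 0)) {D : ℝ}
    (hD : 0 < D) :
    ∑' k : ℕ, ENNReal.ofReal (D / 2 ^ (k + 1)) * g (D / 2 ^ k) ≤ ∫⁻ ε in Ioc 0 D, g ε := by
  set A : ℕ → Set ℝ := fun k => Ioc (D / 2 ^ (k + 1)) (D / 2 ^ k) with hA
  have hanti : Antitone fun k : ℕ => D / 2 ^ k := by
    intro i j hij
    have : (2 : ℝ) ^ i ≤ 2 ^ j := pow_le_pow_right₀ one_le_two hij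
    dsimp only
    gcongr
  have hdisj : Pairwise (Function.onFun Disjoint A) := by
    simpa only [Nat.succ_eq_succ, Order.succ_eq_add_one] using hanti.pairwise_disjoint_on_Ioc_succ
  have hsub : ⋃ k, A k ⊆ Ioc 0 D := by
    refine iUnion_subset fun k ε hε => ⟨lt_trans (by positivity) hε.1, hε.2.trans ?_⟩
    simpa using hanti (Nat.zero_le k)
  calc ∑' k : ℕ, ENNReal.ofReal (D / 2 ^ (k + 1)) * g (D / 2 ^ k)
      ≤ ∑' k : ℕ, ∫⁻ ε in A k, g ε := by
        refine ENNReal.tsum_le_tsum fun k => ?_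
        have e1 : D / 2 ^ k - D / 2 ^ (k + 1) = D / 2 ^ (k + 1) := by
          rw [pow_succ]; field_simp; ring
        calc ENNReal.ofReal (D / 2 ^ (k + 1)) * g (D / 2 ^ k)
            = ∫⁻ _ε in A k, g (D / 2 ^ k) := by
              rw [setLIntegral_const, hA, Real.volume_Ioc, e1, mul_comm]
          _ ≤ ∫⁻ ε in A k, g ε := by
              refine setLIntegral_mono_ae' measurableSet_Ioc (ae_of_all _ fun ε hε => ?_)
              exact hg (lt_trans (by positivity) hε.1) (by rw [mem_Ioi]; positivity) hε.2
    _ = ∫⁻ ε in ⋃ k, A k, g ε := (lintegral_iUnion (fun k => measurableSet_Ioc) hdisj g).symm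
    _ ≤ _ := lintegral_mono_set hsub

variable {X : Type*} [PseudoEMetricSpace X]

theorem entropy_anti : Antitone (entropy X) := by
  intro ε δ h
  refine EReal.toENNReal_le_toENNReal (ENNReal.log_le_log ?_)
  exact ENat.toENNReal_le.2 (Metric.coveringNumber_anti h)

theorem entropy_eq_zero {δ : ℝ≥0} (h : ∀ x y : X, edist x y ≤ δ) : entropy X δ = 0 := by
  refine EReal.toENNReal_eq_zero_iff.2 ?_
  rw [ENNReal.log_le_zero_iff]
  refine le_trans (ENat.toENNReal_le.2 (Metric.coveringNumber_le_one_of_ediam_le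
    (Metric.ediam_le fun x _ y _ => h x y))) ?_
  simp

theorem exists_finset_cover_card_le_exp [Nonempty X] {ε : ℝ≥0} (h : entropy X ε ≠ ∞) :
    ∃ s : Finset X, (∀ x, ∃ y ∈ s, edist x y ≤ ε) ∧
      (s.card : ℝ) ≤ Real.exp (entropy X ε).toReal := by
  have hN : Metric.coveringNumber ε (univ : Set X) ≠ ⊤ := by
    intro hc
    simp [entropy, hc] at h
  obtain ⟨C, -, hCfin, hCcov, hCcard⟩ := Metric.exists_set_encard_eq_coveringNumber hN
  refine ⟨hCfin.toFinset, fun x => ?_, ?_⟩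
  · obtain ⟨y, hy, hxy⟩ := hCcov (mem_univ x)
    exact ⟨y, hCfin.mem_toFinset.2 hy, hxy⟩
  · have hne : hCfin.toFinset.Nonempty := by
      rw [Set.Finite.toFinset_nonempty]
      exact hCcov.nonempty univ_nonempty
    set n := hCfin.toFinset.card with hn
    have hn0 : 0 < n := hne.card_pos
    have hn1 : (0 : ℝ) < n := by exact_mod_cast hn0
    have e1 : entropy X ε = ENNReal.ofReal (Real.log n) := by
      rw [entropy, ← hCcard, hCfin.encard_eq_coe_toFinset_card, ← hn, ENat.toENNReal_coe,
        ENNReal.log_pos_real (by simpa using hn0.ne') (by simp), ENNReal.toReal_natCast]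
      exact EReal.toENNReal_of_ne_top (EReal.coe_ne_top _)
    rw [e1, ENNReal.toReal_ofReal (Real.log_natCast_nonneg n), Real.exp_log hn1]

variable (X) in
/-- The data for chaining with moments of growth `p ^ α`: finite nets of radii tending to `0`,
partitions of unity subordinate to them, and orders `m_k` such that there are at most `exp (2 m_k)`
pairs of points from the nets `k` and `k + 1`, while `∑ (2 m_k) ^ α ε_k` converges. -/
structure EntropyChain (α : ℝ) where
  net : ℕ → Finset X
  radius : ℕ → ℝ≥0
  order : ℕ → ℕ
  weight : ℕ → X → X →ᵇ ℝ
  exists_edist_le : ∀ k x, ∃ y ∈ net k, edist x y ≤ radius k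
  tendsto_radius : Tendsto radius atTop (𝓝 0)
  radius_succ_le : ∀ k, radius (k + 1) ≤ radius k
  isPartitionOfUnity : ∀ k, IsPartitionOfUnity (net k) (2 * radius k) (weight k)
  one_le_order : ∀ k, 1 ≤ order k
  card_mul_card_le : ∀ k, ((net k).card * (net (k + 1)).card : ℝ) ≤ Real.exp (2 * order k : ℕ)
  tsum_ne_top : ∑' k, (((2 * order k : ℕ) : ℝ≥0∞) ^ α * radius k) ≠ ∞

theorem ENNReal.rpow_add_le_two_rpow_mul (a b : ℝ≥0∞) {α : ℝ} (hα : 0 ≤ α) :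
    (a + b) ^ α ≤ 2 ^ α * (a ^ α + b ^ α) := by
  wlog hab : a ≤ b generalizing a b
  · rw [add_comm a, add_comm (a ^ α)]
    exact this b a (not_le.1 hab).le
  calc (a + b) ^ α ≤ (2 * b) ^ α := by
        rw [two_mul]
        gcongr
    _ = 2 ^ α * b ^ α := ENNReal.mul_rpow_of_nonneg _ _ hα
    _ ≤ _ := by
        gcongr
        exact le_add_self

/-- Finiteness of the entropy integral provides nets along which chaining succeeds. -/
theorem nonempty_entropyChain [Nonempty X] {α : ℝ} (hα : 0 < α) {D : ℝ≥0}
    (hD : ∀ x y : X, edist x y ≤ D)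
    (hint : ∫⁻ ε in Ioc (0 : ℝ) D, entropy X ε.toNNReal ^ α < ∞) :
    Nonempty (EntropyChain X α) := by
  -- The radii start from `D + 1`, which is positive even if `D = 0`; beyond `D` the entropy vanishes,
  -- so the integral up to `D + 1` is finite as well.
  set ε : ℕ → ℝ≥0 := fun k => (D + 1) / 2 ^ k with hε
  have hε0 : ∀ k, 0 < ε k := fun k => by positivity
  have hεsucc : ∀ k, (ε k : ℝ≥0∞) = 2 * ε (k + 1) := by
    intro k
    have : ε k = 2 * ε (k + 1) := by
      simp only [hε, pow_succ]
      field_simp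
    rw [this]
    push_cast
    rfl
  have hεreal : ∀ k, ((ε k : ℝ≥0) : ℝ) = (D + 1 : ℝ) / 2 ^ k := fun k => by simp [hε]
  set g : ℝ → ℝ≥0∞ := fun x => entropy X x.toNNReal ^ α with hg
  have hganti : Antitone g := fun x y hxy =>
    ENNReal.rpow_le_rpow (entropy_anti (Real.toNNReal_le_toNNReal hxy)) hα.le
  have hint' : ∫⁻ x in Ioc (0 : ℝ) (D + 1), g x < ∞ := by
    rw [← Ioc_union_Ioc_eq_Ioc (b := (D : ℝ)) D.coe_nonneg (by linarith)]
    refine (lintegral_union_le _ _ _).trans_lt (ENNReal.add_lt_top.2 ⟨hint, ?_⟩)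
    have : ∫⁻ x in Ioc (D : ℝ) (D + 1), g x = 0 := by
      rw [setLIntegral_congr_fun measurableSet_Ioc (g := fun _ => 0), lintegral_zero]
      intro x hx
      simp only [hg]
      rw [entropy_eq_zero fun y z => (hD y z).trans ?_, ENNReal.zero_rpow_of_pos hα]
      exact_mod_cast NNReal.le_toNNReal_of_coe_le hx.1.le
    rw [this]
    exact ENNReal.zero_lt_top
  have hsum : ∑' k, (ε (k + 1) : ℝ≥0∞) * entropy X (ε k) ^ α ≠ ∞ := by
    refine ((tsum_dyadic_mul_le_lintegral (hganti.antitoneOn _) (D := (D : ℝ) + 1)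
      (by positivity)).trans_lt hint').ne_top |> fun h => ?_
    convert! h using 4 with k k
    · rw [← hεreal, ENNReal.ofReal_coe_nnreal]
    · simp only [hg]
      rw [← hεreal, Real.toNNReal_coe]
  have hfin : ∀ k, entropy X (ε k) ≠ ∞ := by
    intro k hk
    refine ENNReal.ne_top_of_tsum_ne_top hsum k ?_
    rw [hk, ENNReal.top_rpow_of_pos hα, ENNReal.mul_top (by simpa using (hε0 (k + 1)).ne')]
  choose s hs hcard using fun k => exists_finset_cover_card_le_exp (hfin k)
  choose w hw using fun k => exists_isPartitionOfUnity (hε0 k) (hs k)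
  refine ⟨⟨s, ε, fun k => ⌈(entropy X (ε (k + 1))).toReal⌉₊ + 1, w, hs, ?_, ?_, hw,
    fun k => by omega, ?_, ?_⟩⟩
  · rw [← NNReal.tendsto_coe]
    refine Tendsto.congr (fun k => (hεreal k).symm) ?_
    exact tendsto_const_nhds.div_atTop (tendsto_pow_atTop_atTop_of_one_lt one_lt_two)
  · intro k
    rw [← ENNReal.coe_le_coe, hεsucc k, two_mul]
    exact le_self_add
  · intro k
    have hmono : (entropy X (ε k)).toReal ≤ (entropy X (ε (k + 1))).toReal := by
      refine ENNReal.toReal_mono (hfin _) (entropy_anti ?_)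
      rw [← ENNReal.coe_le_coe, hεsucc k, two_mul]
      exact le_self_add
    calc ((s k).card * (s (k + 1)).card : ℝ)
        ≤ Real.exp (entropy X (ε (k + 1))).toReal * Real.exp (entropy X (ε (k + 1))).toReal := by
          exact mul_le_mul ((hcard k).trans (Real.exp_le_exp.2 hmono)) (hcard (k + 1))
            (Nat.cast_nonneg _) (Real.exp_pos _).le
      _ = Real.exp (2 * (entropy X (ε (k + 1))).toReal) := by rw [← Real.exp_add, two_mul]
      _ ≤ _ := by
          rw [Real.exp_le_exp]
          push_cast
          linarith [Nat.le_ceil (entropy X (ε (k + 1))).toReal]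
  -- With `m_k = ⌈H(ε_{k+1})⌉ + 1`, the term `(2 m_k) ^ α` is at most a multiple of
  -- `H(ε_{k+1}) ^ α + 1`.
  · have hord : ∀ k, ((2 * (⌈(entropy X (ε (k + 1))).toReal⌉₊ + 1) : ℕ) : ℝ≥0∞) ^ α
        ≤ 2 ^ α * (2 ^ α * (entropy X (ε (k + 1)) ^ α + 2 ^ α)) := by
      intro k
      have h1 : ((2 * (⌈(entropy X (ε (k + 1))).toReal⌉₊ + 1) : ℕ) : ℝ≥0∞)
          ≤ 2 * (entropy X (ε (k + 1)) + 2) := by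
        push_cast
        refine mul_le_mul_right ?_ 2
        have h2 := (Nat.ceil_lt_add_one (a := (entropy X (ε (k + 1))).toReal)
          ENNReal.toReal_nonneg).le
        have h3 : ((⌈(entropy X (ε (k + 1))).toReal⌉₊ : ℕ) : ℝ≥0∞)
            ≤ entropy X (ε (k + 1)) + 1 := by
          rw [← ENNReal.ofReal_natCast]
          refine (ENNReal.ofReal_le_ofReal h2).trans ?_
          rw [ENNReal.ofReal_add ENNReal.toReal_nonneg zero_le_one,
            ENNReal.ofReal_toReal (hfin _), ENNReal.ofReal_one]
        calc ((⌈(entropy X (ε (k + 1))).toReal⌉₊ : ℕ) : ℝ≥0∞) + 1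
            ≤ entropy X (ε (k + 1)) + 1 + 1 := by gcongr
          _ = _ := by rw [add_assoc, one_add_one_eq_two]
      refine (ENNReal.rpow_le_rpow h1 hα.le).trans ?_
      rw [ENNReal.mul_rpow_of_nonneg _ _ hα.le]
      gcongr
      exact ENNReal.rpow_add_le_two_rpow_mul _ _ hα.le
    have hgeom : ∑' k, (ε k : ℝ≥0∞) ≠ ∞ := by
      have h1 : Summable ε := by
        refine NNReal.summable_coe.1 (Summable.congr ?_ fun k => (hεreal k).symm)
        simp only [div_eq_mul_inv, ← inv_pow]
        exact (summable_geometric_of_lt_one (by norm_num) (by norm_num)).mul_left _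
      exact ENNReal.tsum_coe_ne_top_iff_summable.2 h1
    have hsum' : ∑' k, (ε k : ℝ≥0∞) * entropy X (ε (k + 1)) ^ α ≠ ∞ := by
      have h1 : ∑' k, (ε (k + 2) : ℝ≥0∞) * entropy X (ε (k + 1)) ^ α ≠ ∞ :=
        ((ENNReal.tsum_comp_le_tsum_of_injective (add_left_injective 1)
          fun k => (ε (k + 1) : ℝ≥0∞) * entropy X (ε k) ^ α).trans_lt hsum.lt_top).ne
      have h2 : ∀ k, (ε k : ℝ≥0∞) * entropy X (ε (k + 1)) ^ α
          = 4 * ((ε (k + 2) : ℝ≥0∞) * entropy X (ε (k + 1)) ^ α) := by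
        intro k
        rw [hεsucc k, hεsucc (k + 1)]
        ring
      simp only [h2]
      rw [ENNReal.tsum_mul_left]
      exact ENNReal.mul_ne_top (by norm_num) h1
    have h2top : (2 : ℝ≥0∞) ^ α ≠ ∞ := ENNReal.rpow_ne_top_of_nonneg hα.le (by norm_num)
    refine ((ENNReal.tsum_le_tsum (g := fun k => 2 ^ α * (2 ^ α * ((ε k : ℝ≥0∞) *
      entropy X (ε (k + 1)) ^ α + 2 ^ α * ε k))) fun k => ?_).trans_lt (lt_top_iff_ne_top.2 ?_)).ne
    · refine (mul_le_mul_left (hord k) _).trans_eq ?_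
      ring
    · rw [ENNReal.tsum_mul_left, ENNReal.tsum_mul_left, ENNReal.tsum_add, ENNReal.tsum_mul_left]
      exact ENNReal.mul_ne_top h2top (ENNReal.mul_ne_top h2top
        (ENNReal.add_ne_top.2 ⟨hsum', ENNReal.mul_ne_top h2top hgeom⟩))

namespace EntropyChain

variable {α : ℝ} (c : EntropyChain X α) {Ω : Type*} [MeasurableSpace Ω] {P : Measure Ω}

/-- The bound for the `k`-th chaining step. Points of the nets `k` and `k + 1` whose weights are both
nonzero somewhere are at distance at most `2 ε_k + 2 ε_{k+1} ≤ 4 ε_k`. -/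
noncomputable def stepBound (K : ℝ≥0∞) (k : ℕ) : ℝ≥0∞ :=
  ENNReal.ofReal (Real.exp 1) * (K * ((2 * c.order k : ℕ) : ℝ≥0∞) ^ α * (4 * c.radius k))

theorem tsum_stepBound_ne_top {K : ℝ≥0∞} (hK : K ≠ ∞) : ∑' k, c.stepBound K k ≠ ∞ := by
  have : ∀ k, c.stepBound K k = ENNReal.ofReal (Real.exp 1) * (K * 4) *
      (((2 * c.order k : ℕ) : ℝ≥0∞) ^ α * c.radius k) := fun k => by
    rw [stepBound]; ring
  simp only [this]
  rw [ENNReal.tsum_mul_left]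
  exact ENNReal.mul_ne_top (ENNReal.mul_ne_top ENNReal.ofReal_ne_top
    (ENNReal.mul_ne_top hK (by norm_num))) c.tsum_ne_top

/-- The interpolation of the values of `f` at the points of the `k`-th net. -/
noncomputable def interp (k : ℕ) (f : X → ℝ) : X →ᵇ ℝ := _root_.interp (c.net k) (c.weight k) f

/-- One step of the chaining: the moment bound of order `2 m_k` controls the maximum over all pairs
of neighbouring points of two consecutive nets. -/
theorem lintegral_interp_sub_le [IsProbabilityMeasure P] {Y : X → Ω → ℝ}
    (hY : ∀ x, AEStronglyMeasurable (Y x) P)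
    {K : ℝ≥0∞} (hK : ∀ m : ℕ, 1 ≤ m → ∀ x y, ∫⁻ ω, ‖Y x ω - Y y ω‖ₑ ^ (2 * m) ∂P
      ≤ (K * ((2 * m : ℕ) : ℝ≥0∞) ^ α * edist x y) ^ (2 * m)) (k : ℕ) :
    ∫⁻ ω, ‖(c.interp k fun x => Y x ω) - c.interp (k + 1) fun x => Y x ω‖ₑ ∂P
      ≤ c.stepBound K k := by
  refine (lintegral_mono fun ω => (c.isPartitionOfUnity k).enorm_interp_sub_interp_le
    (c.isPartitionOfUnity (k + 1)) fun x => Y x ω).trans ?_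
  refine lintegral_sup_enorm_le _ (g := fun p : X × X => fun ω => Y p.1 ω - Y p.2 ω)
    (fun p => (hY p.1).sub (hY p.2)) (N := 2 * c.order k)
    (by have := c.one_le_order k; omega) (fun p hp => ?_) ?_
  · refine (hK (c.order k) (c.one_le_order k) p.1 p.2).trans ?_
    gcongr
    refine (Finset.mem_filter.1 hp).2.trans ?_
    have h1 : 2 * c.radius k + 2 * c.radius (k + 1) ≤ 4 * c.radius k := by
      have := c.radius_succ_le k
      calc 2 * c.radius k + 2 * c.radius (k + 1) ≤ 2 * c.radius k + 2 * c.radius k := by gcongr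
        _ = _ := by ring
    exact_mod_cast h1
  · refine le_trans ?_ (c.card_mul_card_le k)
    rw [← Nat.cast_mul, ← Finset.card_product]
    exact_mod_cast Finset.card_filter_le _ _

/-- A random field with increments of `L^p` norm at most `K p ^ α` times the distance, for even `p`,
has a continuous modification, and its interpolations converge to it at a rate that depends on `K`
only. -/
theorem exists_modification [IsProbabilityMeasure P] {Y : X → Ω → ℝ}
    (hY : ∀ x, AEStronglyMeasurable (Y x) P)
    {K : ℝ≥0∞} (hα : 0 ≤ α) (hKtop : K ≠ ∞)
    (hK : ∀ m : ℕ, 1 ≤ m → ∀ x y, ∫⁻ ω, ‖Y x ω - Y y ω‖ₑ ^ (2 * m) ∂P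
      ≤ (K * ((2 * m : ℕ) : ℝ≥0∞) ^ α * edist x y) ^ (2 * m)) :
    ∃ Z : Ω → X →ᵇ ℝ, AEStronglyMeasurable Z P ∧ (∀ x, ∀ᵐ ω ∂P, Z ω x = Y x ω) ∧
      ∀ k, ∫⁻ ω, ‖Z ω - c.interp k fun x => Y x ω‖ₑ ∂P ≤ ∑' l, c.stepBound K (k + l) := by
  refine _root_.exists_continuous_modification c.isPartitionOfUnity
    (by simpa using c.tendsto_radius.const_mul 2) hY (K := K * 2 ^ α)
    (ENNReal.mul_ne_top hKtop (ENNReal.rpow_ne_top_of_nonneg hα (by norm_num))) (fun x y => ?_)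
    (c.tsum_stepBound_ne_top hKtop) (c.lintegral_interp_sub_le hY hK)
  refine lintegral_le_of_lintegral_pow_le ((hY x).sub (hY y)).enorm two_ne_zero ?_
  simpa using hK 1 le_rfl x y

/-- Continuous modifications of the same field agree almost surely, since the nets have a countable
dense union. -/
theorem ae_eq_of_forall_ae_eq (c : EntropyChain X α) {Z Z' : Ω → X →ᵇ ℝ}
    (h : ∀ x, ∀ᵐ ω ∂P, Z ω x = Z' ω x) :
    Z =ᵐ[P] Z' := by
  have hdense : Dense (⋃ k, (c.net k : Set X)) := by
    intro x
    rw [EMetric.mem_closure_iff]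
    intro δ hδ
    have h0 : Tendsto (fun k => (c.radius k : ℝ≥0∞)) atTop (𝓝 0) :=
      ENNReal.tendsto_coe.2 c.tendsto_radius
    obtain ⟨k, hk⟩ := (h0.eventually (gt_mem_nhds hδ)).exists
    obtain ⟨y, hy, hxy⟩ := c.exists_edist_le k x
    exact ⟨y, mem_iUnion.2 ⟨k, hy⟩, hxy.trans_lt hk⟩
  have hcount : (⋃ k, (c.net k : Set X)).Countable :=
    countable_iUnion fun k => (c.net k).countable_toSet
  filter_upwards [(ae_ball_iff hcount).2 fun x _ => h x] with ω hω
  exact DFunLike.coe_injective ((Z ω).continuous.ext_on hdense (Z' ω).continuous hω)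

end EntropyChain

end Entropy

/-! ### Normed sums of martingale differences -/

section NormedSums

variable {Ω : Type*} {mΩ : MeasurableSpace Ω} {P : Measure Ω}

theorem lintegral_enorm_normed_sum_pow_le [IsFiniteMeasure P] (F : Filtration ℕ mΩ)
    {d : ℕ → Ω → ℝ} (hF : ∀ i, 1 ≤ i → AEStronglyMeasurable[F i] (d i) P)
    (hint : ∀ i, 1 ≤ i → Integrable (d i) P)
    (h0 : ∀ i, P[d (i + 1) | F i] =ᵐ[P] 0) {m : ℕ} (hm : 1 ≤ m) (b : ℕ → ℝ≥0)
    (hb : ∀ i, 1 ≤ i → ∫⁻ ω, ‖d i ω‖ₑ ^ (2 * m) ∂P ≤ (b i : ℝ≥0∞) ^ (2 * m)) (n : ℕ) :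
    ∫⁻ ω, ‖(Real.sqrt n)⁻¹ * ∑ i ∈ Finset.Icc 1 n, d i ω‖ₑ ^ (2 * m) ∂P
      ≤ (5 * m * ((n : ℝ≥0∞)⁻¹ * ∑ i ∈ Finset.Icc 1 n, (b i : ℝ≥0∞) ^ 2)) ^ m := by
  rcases n.eq_zero_or_pos with rfl | hn
  · simp [show m ≠ 0 by omega]
  have hn' : (0 : ℝ) < n := by exact_mod_cast hn
  have h1 : ‖(Real.sqrt n)⁻¹‖ₑ ^ (2 * m) = ((n : ℝ≥0∞)⁻¹) ^ m := by
    rw [pow_mul, ← enorm_pow, inv_pow, Real.sq_sqrt hn'.le,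
      Real.enorm_of_nonneg (inv_nonneg.2 hn'.le), ENNReal.ofReal_inv_of_pos hn',
      ENNReal.ofReal_natCast]
  simp only [enorm_mul, mul_pow _ _ (2 * m), h1]
  rw [lintegral_const_mul' _ _ (by simp [hn.ne'])]
  refine (mul_le_mul_right (lintegral_enorm_sum_pow_le F hF hint h0 hm b hb n) _).trans_eq ?_
  rw [← mul_pow]
  congr 1
  push_cast
  ring

end NormedSums

namespace MartingaleDifferenceField

variable {X : Type*} {Ω : Type*} [MeasurableSpace Ω] {P : Measure Ω}

theorem aestronglyMeasurable_filtration (M : MartingaleDifferenceField X P) {i : ℕ} (hi : 1 ≤ i)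
    (x : X) : AEStronglyMeasurable[M.F i] (M.ξ i x) P :=
  stronglyMeasurable_condExp.aestronglyMeasurable.congr (M.condExp_self i hi x)

theorem aestronglyMeasurable_η (M : MartingaleDifferenceField X P) (n : ℕ) (x : X) :
    AEStronglyMeasurable (M.η n x) P :=
  (Finset.aestronglyMeasurable_fun_sum _ fun i hi =>
    (M.integrable i (Finset.mem_Icc.1 hi).1 x).aestronglyMeasurable).const_mul _

theorem lintegral_enorm_ξ_sub_pow_le (M : MartingaleDifferenceField X P) (q : ℝ) {i : ℕ}
    (hi : 1 ≤ i) {m : ℕ} (hm : 1 ≤ m) (x y : X) :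
    ∫⁻ ω, ‖M.ξ i x ω - M.ξ i y ω‖ₑ ^ (2 * m) ∂P
      ≤ (((2 * m : ℕ) : ℝ≥0∞) ^ (1 / q) * M.rho q x y) ^ (2 * m) := by
  have hp0 : (0 : ℝ) < (2 * m : ℕ) := by exact_mod_cast (by omega : 0 < 2 * m)
  have hp : (2 : ℝ) ≤ (2 * m : ℕ) := by exact_mod_cast (by omega : 2 ≤ 2 * m)
  have h1 : eLpNorm (M.ξ i x - M.ξ i y) (ENNReal.ofReal (2 * m : ℕ)) P /
      ENNReal.ofReal (((2 * m : ℕ) : ℝ) ^ (1 / q)) ≤ M.rho q x y :=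
    (le_iSup₂ (f := fun (p : ℝ) (_ : 2 ≤ p) => eLpNorm (M.ξ i x - M.ξ i y) (ENNReal.ofReal p) P /
      ENNReal.ofReal (p ^ (1 / q))) _ hp).trans
      (le_iSup₂ (f := fun (k : ℕ) (_ : 1 ≤ k) => qNorm P q (M.ξ k x - M.ξ k y)) i hi)
  rw [ENNReal.div_le_iff (by simpa using Real.rpow_pos_of_pos hp0 _) ENNReal.ofReal_ne_top,
    ← ENNReal.ofReal_rpow_of_pos hp0, ENNReal.ofReal_natCast] at h1
  have h2 := eLpNorm_nnreal_pow_eq_lintegral (μ := P) (f := M.ξ i x - M.ξ i y)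
    (p := ((2 * m : ℕ) : ℝ≥0)) (by exact_mod_cast (by omega : 2 * m ≠ 0))
  simp only [NNReal.coe_natCast, ENNReal.rpow_natCast, ENNReal.coe_natCast, Pi.sub_apply] at h2
  rw [← h2]
  exact pow_le_pow_left' (h1.trans_eq (mul_comm _ _)) _

theorem condExp_ξ_sub (M : MartingaleDifferenceField X P) (i : ℕ) (x y : X) :
    P[M.ξ (i + 1) x - M.ξ (i + 1) y | M.F i] =ᵐ[P] 0 := by
  filter_upwards [condExp_sub (M.integrable (i + 1) (by omega) x)
    (M.integrable (i + 1) (by omega) y) (M.F i), M.condExp_of_lt (i + 1) i (by omega) x,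
    M.condExp_of_lt (i + 1) i (by omega) y] with ω h h1 h2
  simp [h, h1, h2]

theorem integral_ξ [IsProbabilityMeasure P] (M : MartingaleDifferenceField X P) {i : ℕ}
    (hi : 1 ≤ i) (x : X) : ∫ ω, M.ξ i x ω ∂P = 0 := by
  rw [← integral_condExp (M.F.le 0)]
  exact integral_eq_zero_of_ae (M.condExp_of_lt i 0 hi x)

/-- The increments of all the normed sums `η_n` have `L^p` norms at most `3 p ^ (1/2 + 1/q) ρ_q`, for
even `p`. -/
theorem lintegral_enorm_η_sub_pow_le [IsProbabilityMeasure P] (M : MartingaleDifferenceField X P)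
    (q : ℝ) {n m : ℕ} (hm : 1 ≤ m) (x y : X) (hxy : M.rho q x y ≠ ∞) :
    ∫⁻ ω, ‖M.η n x ω - M.η n y ω‖ₑ ^ (2 * m) ∂P
      ≤ (3 * ((2 * m : ℕ) : ℝ≥0∞) ^ (1 / 2 + 1 / q) * M.rho q x y) ^ (2 * m) := by
  have hp0 : ((2 * m : ℕ) : ℝ≥0∞) ≠ 0 := by exact_mod_cast (by omega : 2 * m ≠ 0)
  have hptop : ((2 * m : ℕ) : ℝ≥0∞) ≠ ∞ := ENNReal.natCast_ne_top _
  set B : ℝ≥0∞ := ((2 * m : ℕ) : ℝ≥0∞) ^ (1 / q) * M.rho q x y with hB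
  have hBtop : B ≠ ∞ := ENNReal.mul_ne_top (ENNReal.rpow_ne_top_of_ne_zero hp0 hptop) hxy
  have h := lintegral_enorm_normed_sum_pow_le M.F (d := fun i => M.ξ i x - M.ξ i y)
    (fun i hi => (M.aestronglyMeasurable_filtration hi x).sub
      (M.aestronglyMeasurable_filtration hi y))
    (fun i hi => (M.integrable i hi x).sub (M.integrable i hi y))
    (fun i => M.condExp_ξ_sub i x y) hm (fun _ => B.toNNReal) (fun i hi => by
      rw [ENNReal.coe_toNNReal hBtop]
      exact M.lintegral_enorm_ξ_sub_pow_le q hi hm x y) n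
  have e1 : ∀ ω, M.η n x ω - M.η n y ω
      = (Real.sqrt n)⁻¹ * ∑ i ∈ Finset.Icc 1 n, (M.ξ i x - M.ξ i y) ω := fun ω => by
    simp only [η, Pi.sub_apply, Finset.sum_sub_distrib, mul_sub]
  simp only [e1]
  refine h.trans ?_
  rw [pow_mul]
  refine pow_le_pow_left' ?_ m
  have e2 : (3 * ((2 * m : ℕ) : ℝ≥0∞) ^ (1 / 2 + 1 / q) * M.rho q x y) ^ 2
      = 9 * (2 * m) * B ^ 2 := by
    have e3 : (((2 * m : ℕ) : ℝ≥0∞) ^ (1 / 2 : ℝ)) ^ 2 = 2 * m := by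
      rw [← ENNReal.rpow_natCast, ← ENNReal.rpow_mul]
      norm_num
    rw [ENNReal.rpow_add _ _ hp0 hptop, hB, mul_pow, mul_pow, mul_pow, e3, mul_pow]
    ring
  rw [e2, ENNReal.coe_toNNReal hBtop, Finset.sum_const, Nat.card_Icc, nsmul_eq_mul,
    Nat.add_sub_cancel, ← mul_assoc (n : ℝ≥0∞)⁻¹]
  calc (5 : ℝ≥0∞) * m * ((n : ℝ≥0∞)⁻¹ * n * B ^ 2) ≤ 18 * m * (1 * B ^ 2) := by
        gcongr
        · norm_num
        · exact ENNReal.inv_mul_le_one _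
    _ = _ := by ring

/-- Finiteness of `σ²` bounds the variances, and so the first moments, of `η_n` at some point. -/
theorem exists_lintegral_enorm_η_le [IsProbabilityMeasure P] (M : MartingaleDifferenceField X P)
    (hsigma : M.sigmaSq < ∞) : ∃ x : X, ∃ C : ℝ≥0∞, C ≠ ∞ ∧ ∀ n, ∫⁻ ω, ‖M.η n x ω‖ₑ ∂P ≤ C := by
  obtain ⟨x, hx⟩ := iInf_lt_iff.1 hsigma
  set V : ℝ≥0∞ := ⨆ (n : ℕ) (_ : 1 ≤ n),
    (n : ℝ≥0∞)⁻¹ * ∑ k ∈ Finset.Icc 1 n, evariance (M.ξ k x) P with hV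
  have hle : ∀ n : ℕ, 1 ≤ n →
      (n : ℝ≥0∞)⁻¹ * ∑ k ∈ Finset.Icc 1 n, evariance (M.ξ k x) P ≤ V := fun n hn =>
    le_iSup₂ (f := fun (n : ℕ) (_ : 1 ≤ n) =>
      (n : ℝ≥0∞)⁻¹ * ∑ k ∈ Finset.Icc 1 n, evariance (M.ξ k x) P) n hn
  have hvar : ∀ k, 1 ≤ k → evariance (M.ξ k x) P ≠ ∞ := by
    intro k hk hc
    refine ((hle k hk).trans_lt hx).ne ?_
    rw [ENNReal.sum_eq_top.2 ⟨k, Finset.mem_Icc.2 ⟨hk, le_rfl⟩, hc⟩]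
    exact ENNReal.mul_top (by simp)
  have hsq : ∀ k, 1 ≤ k →
      (((evariance (M.ξ k x) P).toNNReal.sqrt : ℝ≥0) : ℝ≥0∞) ^ 2 = evariance (M.ξ k x) P := by
    intro k hk
    rw [← ENNReal.coe_pow, NNReal.sq_sqrt, ENNReal.coe_toNNReal (hvar k hk)]
  refine ⟨x, (5 * V) ^ (1 / 2 : ℝ), ENNReal.rpow_ne_top_of_nonneg (by norm_num)
    (ENNReal.mul_ne_top (by norm_num) hx.ne), fun n => ?_⟩
  refine lintegral_le_of_lintegral_pow_le (M.aestronglyMeasurable_η n x).enorm two_ne_zero ?_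
  have h := lintegral_enorm_normed_sum_pow_le M.F (d := fun i => M.ξ i x)
    (fun i hi => M.aestronglyMeasurable_filtration hi x) (fun i hi => M.integrable i hi x)
    (fun i => M.condExp_of_lt (i + 1) i (by omega) x) le_rfl
    (fun k => (evariance (M.ξ k x) P).toNNReal.sqrt) (fun i hi => by
      rw [mul_one, hsq i hi, evariance, M.integral_ξ hi x]
      simp) n
  rw [mul_one, pow_one, Nat.cast_one, mul_one,
    Finset.sum_congr rfl fun k hk => hsq k (Finset.mem_Icc.1 hk).1] at h
  refine h.trans ?_
  have e1 : ((5 * V) ^ (1 / 2 : ℝ)) ^ 2 = 5 * V := by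
    rw [← ENNReal.rpow_natCast, ← ENNReal.rpow_mul]
    norm_num
  rw [e1]
  rcases n.eq_zero_or_pos with rfl | hn
  · simp
  · gcongr
    exact hle n hn

theorem edist_def (M : MartingaleDifferenceField X P) (q : ℝ) (x y : M.Space q) :
    edist x y = M.rho q x y := rfl

end MartingaleDifferenceField

theorem theorem2p2 {X : Type*} {Ω : Type*} [MeasurableSpace Ω] (P : Measure Ω)
    [IsProbabilityMeasure P] (M : MartingaleDifferenceField X P) (q : ℝ) (hq : 0 < q)
    (hbdd : ∃ C : ℝ≥0, ∀ x y : X, M.rho q x y ≤ C)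
    (hsigma : M.sigmaSq < ∞)
    (hentropy : ∫⁻ ε in Set.Ioc 0 (M.diam q).toReal,
      entropy (M.Space q) (Real.toNNReal ε) ^ ((2 + q) / (2 * q)) < ∞) :
    (∀ i : ℕ, 1 ≤ i → ∃ Z : Ω → M.ContFun q,
      AEMeasurable Z P ∧ M.IsContinuousModification q (M.ξ i) Z) ∧
    (∀ Z : ℕ → Ω → M.ContFun q,
      (∀ n : ℕ, 1 ≤ n → M.IsContinuousModification q (M.η n) (Z n)) →
        (∀ n : ℕ, 1 ≤ n → AEMeasurable (Z n) P) ∧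
        IsTightMeasureSet {(ν : Measure (M.ContFun q)) | ν ∈ M.laws q Z} ∧
        IsCompact (closure (M.laws q Z))) := by
  obtain ⟨C, hC⟩ := hbdd
  have hfin : ∀ x y : X, M.rho q x y ≠ ∞ := fun x y => ((hC x y).trans_lt ENNReal.coe_lt_top).ne
  have hdiam : M.diam q ≠ ∞ := ((iSup₂_le hC).trans_lt ENNReal.coe_lt_top).ne
  have hα : (2 + q) / (2 * q) = 1 / 2 + 1 / q := by field_simp; ring
  have hα0 : 0 < 1 / 2 + 1 / q := by positivity
  obtain ⟨x₀, C₀, hC₀, hx₀⟩ := M.exists_lintegral_enorm_η_le hsigma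
  have : Nonempty (M.Space q) := ⟨M.toSpace q x₀⟩
  obtain ⟨c⟩ : Nonempty (EntropyChain (M.Space q) (1 / 2 + 1 / q)) := by
    refine nonempty_entropyChain hα0 (D := (M.diam q).toNNReal) (fun x y => ?_) ?_
    · rw [ENNReal.coe_toNNReal hdiam]
      exact le_iSup₂ (f := fun x y : X => M.rho q x y) x y
    · rw [← hα]
      exact hentropy
  have hξK : ∀ i, 1 ≤ i → ∀ m : ℕ, 1 ≤ m → ∀ x y : M.Space q,
      ∫⁻ ω, ‖M.ξ i x ω - M.ξ i y ω‖ₑ ^ (2 * m) ∂P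
        ≤ (1 * ((2 * m : ℕ) : ℝ≥0∞) ^ (1 / 2 + 1 / q) * edist x y) ^ (2 * m) := by
    intro i hi m hm x y
    refine (M.lintegral_enorm_ξ_sub_pow_le q hi hm x y).trans ?_
    rw [one_mul, M.edist_def]
    gcongr
    · exact_mod_cast (by omega : 1 ≤ 2 * m)
    · linarith
  have hηK : ∀ n, ∀ m : ℕ, 1 ≤ m → ∀ x y : M.Space q,
      ∫⁻ ω, ‖M.η n x ω - M.η n y ω‖ₑ ^ (2 * m) ∂P
        ≤ (3 * ((2 * m : ℕ) : ℝ≥0∞) ^ (1 / 2 + 1 / q) * edist x y) ^ (2 * m) :=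
    fun n m hm x y => M.lintegral_enorm_η_sub_pow_le q hm x y (hfin x y)
  have hηm : ∀ n (x : M.Space q), AEStronglyMeasurable (M.η n x) P := fun n x =>
    M.aestronglyMeasurable_η n x
  refine ⟨fun i hi => ?_, fun Z hZ => ?_⟩
  · obtain ⟨Z, hZm, hZ, -⟩ := c.exists_modification (P := P) (Y := M.ξ i)
      (fun x => (M.integrable i hi x).aestronglyMeasurable) hα0.le ENNReal.one_ne_top (hξK i hi)
    exact ⟨Z, hZm.aemeasurable, hZ⟩
  · choose Z' hZ'm hZ' hZ'τ using fun n => c.exists_modification (P := P) (Y := M.η n)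
      (hηm n) hα0.le (by norm_num : (3 : ℝ≥0∞) ≠ ∞) (hηK n)
    have hZZ' : ∀ n, 1 ≤ n → Z n =ᵐ[P] Z' n := fun n hn =>
      c.ae_eq_of_forall_ae_eq fun x => by
        filter_upwards [hZ n hn x, hZ' n x] with ω h1 h2
        exact h1.trans h2.symm
    have hmean : ∀ n (x : M.Space q), ∫⁻ ω, ‖M.η n x ω‖ₑ ∂P
        ≤ 3 * 2 ^ (1 / 2 + 1 / q) * M.rho q x x₀ + C₀ := by
      intro n x
      have h1 : ∫⁻ ω, ‖M.η n x ω - M.η n x₀ ω‖ₑ ∂P ≤ 3 * 2 ^ (1 / 2 + 1 / q) * M.rho q x x₀ := by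
        refine lintegral_le_of_lintegral_pow_le ((hηm n x).sub (hηm n x₀)).enorm two_ne_zero ?_
        simpa using M.lintegral_enorm_η_sub_pow_le q (n := n) le_rfl x x₀ (hfin x x₀)
      calc ∫⁻ ω, ‖M.η n x ω‖ₑ ∂P
          ≤ ∫⁻ ω, ‖M.η n x ω - M.η n x₀ ω‖ₑ + ‖M.η n x₀ ω‖ₑ ∂P := by
            refine lintegral_mono fun ω => ?_
            simpa using enorm_add_le (M.η n x ω - M.η n x₀ ω) (M.η n x₀ ω)
        _ = ∫⁻ ω, ‖M.η n x ω - M.η n x₀ ω‖ₑ ∂P + ∫⁻ ω, ‖M.η n x₀ ω‖ₑ ∂P :=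
            lintegral_add_right' _ (hηm n x₀).enorm
        _ ≤ _ := add_le_add h1 (hx₀ n)
    have htail : Tendsto (fun k => ∑' l, c.stepBound 3 (k + l)) atTop (𝓝 0) := by
      simpa only [add_comm] using
        ENNReal.tendsto_sum_nat_add _ (c.tsum_stepBound_ne_top (by norm_num : (3 : ℝ≥0∞) ≠ ∞))
    have htight : IsTightMeasureSet {(ν : Measure (M.ContFun q)) | ν ∈ M.laws q Z} := by
      refine (isTightMeasureSet_map_of_interp hηm (fun x => ?_) hmean hZ'm htail hZ'τ).subset ?_
      · exact ENNReal.add_ne_top.2 ⟨ENNReal.mul_ne_top (ENNReal.mul_ne_top (by norm_num)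
          (ENNReal.rpow_ne_top_of_nonneg hα0.le (by norm_num))) (hfin x x₀), hC₀⟩
      · rintro _ ⟨ν, ⟨n, hn, hν⟩, rfl⟩
        exact ⟨n, by rw [hν, Measure.map_congr (hZZ' n hn)]⟩
    exact ⟨fun n hn => (hZ'm n).aemeasurable.congr (hZZ' n hn).symm, htight,
      isCompact_closure_of_isTightMeasureSet htight⟩
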